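/- Let $M$ be a smooth manifold of dimension $2n+1$ with an almost contact metric structure $(\phi,\xi,\eta,g)$: $\phi$ is a $(1,1)$-tensor field, $\xi$ a vector field, $\eta$ a $1$-form and $g$ a Riemannian metric (all smooth) with $\eta(\xi)=1$, $\phi^2=-I+\eta\otimes\xi$, $\eta\circ\phi=0$, $\phi\xi=0$, $g(\phi X,\phi Y)=g(X,Y)-\eta(X)\eta(Y)$ and $g(X,\xi)=\eta(X)$. Suppose that $M$ is almost cosymplectic, i.e. $d\eta=0$ and $d\omega=0$ for $\omega(X,Y)=g(\phi X,Y)$, and that it is an almost cosymplectic $(\kappa,\mu)$-manifold with $\kappa<0$: there are real constants $\kappa<0$ and $\mu$ such that, with $h=\tfrac12\mathcal L_\xi\phi$ and with the curvature $R(X,Y)=[\nabla_X,\nabla_Y]-\nabla_{[X,Y]}$ of the Levi-Civita connection $\nabla$ of $g$, $$R(X,Y)\xi=\kappa\bigl(\eta(Y)X-\eta(X)Y\bigr)+\mu\bigl(\eta(Y)hX-\eta(X)hY\bigr)$$ for all vector fields $X,Y$. Suppose that $M$ admits a closed Einstein–Weyl structure, i.e. a torsion-free linear connection $D$ and a closed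 $1$-form $\theta$ with $Dg=-2\theta\otimes g$ such that the Ricci tensor of $D$, $\mathrm{Ric}^D(Y,Z)=\mathrm{tr}\,(X\mapsto R^D(X,Y)Z)$, satisfies $\mathrm{Ric}^D(Y,X)+\mathrm{Ric}^D(X,Y)=\Lambda\, g(Y,X)$ for some $\Lambda\in C^\infty(M)$. Then $M$ is Einstein ($\mathrm{Ric}=c\,g$ for a constant $c$) or cosymplectic (the almost contact structure is normal: the almost complex structure $J(X,s\,\tfrac{d}{dt})=(\phi X-s\xi,\ \eta(X)\tfrac{d}{dt})$ on $M\times\mathbb R$ is integrable). -/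

import Mathlib

open Bundle VectorField
open scoped Manifold ContDiff

noncomputable section

/-! ### Differential forms, connections and curvature on a smooth manifold

Vector fields are functions `X : Π x : M, TangentSpace I x`. For a covariant derivative `D` on the
tangent bundle, Mathlib's `D Y x (X x)` is `(D_X Y)(x)`; `d% f x (X x)` is `(X f)(x)`, and
`mlieBracket` is the Lie bracket of vector fields. -/

section Manifold

variable {E : Type*} [NormedAddCommGroup E] [NormedSpace ℝ E]
  {H : Type*} [TopologicalSpace H] (I : ModelWithCorners ℝ E H)
  {M : Type*} [TopologicalSpace M] [ChartedSpace H M] [IsManifold I ∞ M]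

/-- The vector field `X` is differentiable at `x`. -/
abbrev DiffVectorFieldAt (X : Π x : M, TangentSpace I x) (x : M) : Prop :=
  MDiffAt (T% X) x

/-- The vector field `X` is smooth at `x`. -/
abbrev SmoothVectorFieldAt (X : Π x : M, TangentSpace I x) (x : M) : Prop :=
  CMDiffAt ∞ (T% X) x

/-- The vector field `X` is smooth. -/
abbrev SmoothVectorField (X : Π x : M, TangentSpace I x) : Prop :=
  CMDiff ∞ (T% X)

/-- Smoothness of a 1-form (a section of the cotangent bundle). -/
def IsSmoothOneForm (α : Π x : M, TangentSpace I x →L[ℝ] ℝ) : Prop :=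
  ContMDiff I (I.prod 𝓘(ℝ, E →L[ℝ] ℝ)) ∞
    (fun x ↦ TotalSpace.mk' (E →L[ℝ] ℝ)
      (E := fun x : M ↦ TangentSpace I x →L[ℝ] Bundle.Trivial M ℝ x) x (α x))

/-- Smoothness of a `(1,1)`-tensor field (a section of the endomorphism bundle of `TM`). -/
def IsSmoothEndomorphismField (φ : Π x : M, TangentSpace I x →L[ℝ] TangentSpace I x) : Prop :=
  ContMDiff I (I.prod 𝓘(ℝ, E →L[ℝ] E)) ∞
    (fun x ↦ TotalSpace.mk' (E →L[ℝ] E)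
      (E := fun x : M ↦ TangentSpace I x →L[ℝ] TangentSpace I x) x (φ x))

variable {I}

/-- `dα(X, Y) = X(α(Y)) - Y(α(X)) - α([X, Y])` for a 1-form `α`. -/
def extDerivOneForm (α : Π x : M, TangentSpace I x →L[ℝ] ℝ)
    (X Y : Π x : M, TangentSpace I x) (x : M) : ℝ :=
  d% (fun y ↦ α y (Y y)) x (X x) - d% (fun y ↦ α y (X y)) x (Y x) - α x (mlieBracket I X Y x)

/-- `dβ(X, Y, Z)` for a 2-form `β`, by the invariant formula. -/
def extDerivTwoForm (β : Π x : M, TangentSpace I x → TangentSpace I x → ℝ)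
    (X Y Z : Π x : M, TangentSpace I x) (x : M) : ℝ :=
  d% (fun y ↦ β y (Y y) (Z y)) x (X x)
    - d% (fun y ↦ β y (X y) (Z y)) x (Y x)
    + d% (fun y ↦ β y (X y) (Y y)) x (Z x)
    - β x (mlieBracket I X Y x) (Z x)
    + β x (mlieBracket I X Z x) (Y x)
    - β x (mlieBracket I Y Z x) (X x)

/-- `dα = 0`. -/
def IsClosedOneForm (α : Π x : M, TangentSpace I x →L[ℝ] ℝ) : Prop :=
  ∀ (x : M) (X Y : Π x : M, TangentSpace I x),
    DiffVectorFieldAt I X x → DiffVectorFieldAt I Y x → extDerivOneForm α X Y x = 0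

/-- `dβ = 0`. -/
def IsClosedTwoForm (β : Π x : M, TangentSpace I x → TangentSpace I x → ℝ) : Prop :=
  ∀ (x : M) (X Y Z : Π x : M, TangentSpace I x),
    DiffVectorFieldAt I X x → DiffVectorFieldAt I Y x → DiffVectorFieldAt I Z x →
      extDerivTwoForm β X Y Z x = 0

/-- The curvature `R(X, Y)Z = D_X D_Y Z - D_Y D_X Z - D_[X, Y] Z`. -/
def curvature (D : CovariantDerivative I E (TangentSpace I : M → Type _))
    (X Y Z : Π x : M, TangentSpace I x) (x : M) : TangentSpace I x :=
  D (fun y ↦ D Z y (Y y)) x (X x) - D (fun y ↦ D Z y (X y)) x (Y x)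
    - D Z x (mlieBracket I X Y x)

/-- The Ricci tensor `Ric(v, w)`, the trace of `u ↦ R(u, v)w` on the tangent space at `x`.
The trace is the sum of the diagonal coefficients in a basis of the tangent space; the value of
`R` on tangent vectors is computed on extensions to vector fields that are smooth near `x`
(`R` is a tensor, so that the choice does not matter). -/
def ricci [FiniteDimensional ℝ E] (D : CovariantDerivative I E (TangentSpace I : M → Type _))
    (x : M) (v w : TangentSpace I x) : ℝ :=
  letI b : Module.Basis (Fin (Module.finrank ℝ E)) ℝ (TangentSpace I x) := Module.finBasis ℝ E
  ∑ i, b.repr (curvature D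
    (FiberBundle.extend E (b i)) (FiberBundle.extend E v) (FiberBundle.extend E w) x) i

/-- A smooth linear connection on `TM` without torsion. On every open set it sends smooth vector
fields to smooth sections of `Hom(TM, TM)`. -/
structure IsSmoothTorsionFree (D : CovariantDerivative I E (TangentSpace I : M → Type _)) :
    Prop where
  smooth : ∀ U : Set M, IsOpen U → ContMDiffCovariantDerivativeOn E ∞ D.toFun U
  torsion_free : ∀ (x : M) (X Y : Π x : M, TangentSpace I x),
    DiffVectorFieldAt I X x → DiffVectorFieldAt I Y x →
      D Y x (X x) - D X x (Y x) = mlieBracket I X Y x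

/-- `D` is a Weyl connection of the conformal class `[g]`, with Lee form `θ` with respect to `g`:
a torsion-free connection with `Dg = -2 θ ⊗ g`. -/
structure IsWeylConnection (g : ContMDiffRiemannianMetric I ∞ E (TangentSpace I : M → Type _))
    (θ : Π x : M, TangentSpace I x →L[ℝ] ℝ)
    (D : CovariantDerivative I E (TangentSpace I : M → Type _)) : Prop
    extends IsSmoothTorsionFree D where
  smooth_lee : IsSmoothOneForm I θ
  deriv_metric : ∀ (x : M) (u : TangentSpace I x) (Y Z : Π x : M, TangentSpace I x),
    DiffVectorFieldAt I Y x → DiffVectorFieldAt I Z x →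
      d% (fun y ↦ g.inner y (Y y) (Z y)) x u
        - g.inner x (D Y x u) (Z x) - g.inner x (Y x) (D Z x u)
        = -2 * θ x u * g.inner x (Y x) (Z x)

/-- `nab` is the Levi-Civita connection of `g`: the torsion-free connection with `∇g = 0`. -/
structure IsLeviCivita (g : ContMDiffRiemannianMetric I ∞ E (TangentSpace I : M → Type _))
    (nab : CovariantDerivative I E (TangentSpace I : M → Type _)) : Prop
    extends IsSmoothTorsionFree nab where
  deriv_metric : ∀ (x : M) (u : TangentSpace I x) (Y Z : Π x : M, TangentSpace I x),
    DiffVectorFieldAt I Y x → DiffVectorFieldAt I Z x →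
      d% (fun y ↦ g.inner y (Y y) (Z y)) x u
        = g.inner x (nab Y x u) (Z x) + g.inner x (Y x) (nab Z x u)

variable [FiniteDimensional ℝ E]

/-- The symmetrized Ricci tensor of `D` is a smooth multiple of `g`. -/
def IsEinsteinWeyl (g : ContMDiffRiemannianMetric I ∞ E (TangentSpace I : M → Type _))
    (D : CovariantDerivative I E (TangentSpace I : M → Type _)) : Prop :=
  ∃ Λ : M → ℝ, CMDiff ∞ Λ ∧
    ∀ (x : M) (v w : TangentSpace I x), ricci D x w v + ricci D x v w = Λ x * g.inner x w v

/-- There is a Weyl structure `(D, [g])` that is closed and Einstein-Weyl. -/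
def AdmitsClosedEinsteinWeyl
    (g : ContMDiffRiemannianMetric I ∞ E (TangentSpace I : M → Type _)) : Prop :=
  ∃ (D : CovariantDerivative I E (TangentSpace I : M → Type _))
    (θ : Π x : M, TangentSpace I x →L[ℝ] ℝ),
    IsWeylConnection g θ D ∧ IsClosedOneForm θ ∧ IsEinsteinWeyl g D

/-- `Ric = c g` for a constant `c`, where `nab` is the Levi-Civita connection of `g`. -/
def IsEinstein (g : ContMDiffRiemannianMetric I ∞ E (TangentSpace I : M → Type _))
    (nab : CovariantDerivative I E (TangentSpace I : M → Type _)) : Prop :=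
  ∃ c : ℝ, ∀ (x : M) (v w : TangentSpace I x), ricci nab x v w = c * g.inner x v w

end Manifold

/-! ### Almost contact metric structures -/

/-- An almost contact metric structure `(φ, ξ, η, g)` on a `(2n+1)`-dimensional manifold. -/
structure AlmostContactMetricStructure (n : ℕ) (M : Type*) [TopologicalSpace M]
    [ChartedSpace (EuclideanSpace ℝ (Fin (2 * n + 1))) M] [IsManifold (𝓡 (2 * n + 1)) ∞ M] where
  φ : Π x : M, TangentSpace (𝓡 (2 * n + 1)) x →L[ℝ] TangentSpace (𝓡 (2 * n + 1)) x
  ξ : Π x : M, TangentSpace (𝓡 (2 * n + 1)) x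
  η : Π x : M, TangentSpace (𝓡 (2 * n + 1)) x →L[ℝ] ℝ
  g : ContMDiffRiemannianMetric (𝓡 (2 * n + 1)) ∞ (EuclideanSpace ℝ (Fin (2 * n + 1)))
    (TangentSpace (𝓡 (2 * n + 1)) : M → Type _)
  smooth_φ : IsSmoothEndomorphismField (𝓡 (2 * n + 1)) φ
  smooth_ξ : SmoothVectorField (𝓡 (2 * n + 1)) ξ
  smooth_η : IsSmoothOneForm (𝓡 (2 * n + 1)) η
  η_ξ : ∀ x : M, η x (ξ x) = 1
  φ_φ : ∀ (x : M) (v : TangentSpace (𝓡 (2 * n + 1)) x), φ x (φ x v) = -v + η x v • ξ x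
  η_φ : ∀ (x : M) (v : TangentSpace (𝓡 (2 * n + 1)) x), η x (φ x v) = 0
  φ_ξ : ∀ x : M, φ x (ξ x) = 0
  g_φ_φ : ∀ (x : M) (v w : TangentSpace (𝓡 (2 * n + 1)) x),
    g.inner x (φ x v) (φ x w) = g.inner x v w - η x v * η x w
  g_ξ : ∀ (x : M) (v : TangentSpace (𝓡 (2 * n + 1)) x), g.inner x v (ξ x) = η x v

namespace AlmostContactMetricStructure

variable {n : ℕ} {M : Type*} [TopologicalSpace M]
  [ChartedSpace (EuclideanSpace ℝ (Fin (2 * n + 1))) M] [IsManifold (𝓡 (2 * n + 1)) ∞ M]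
  (S : AlmostContactMetricStructure n M)

/-- The fundamental 2-form `ω(v, w) = g(φ v, w)`. -/
def fundamentalForm (x : M) (v w : TangentSpace (𝓡 (2 * n + 1)) x) : ℝ :=
  S.g.inner x (S.φ x v) w

/-- The operator `h = (1/2) L_ξ φ`, i.e. `hX = (1/2) ([ξ, φX] - φ[ξ, X])`, on vector fields. -/
def h (X : Π x : M, TangentSpace (𝓡 (2 * n + 1)) x) (x : M) :
    TangentSpace (𝓡 (2 * n + 1)) x :=
  (1 / 2 : ℝ) • (mlieBracket (𝓡 (2 * n + 1)) S.ξ (fun y ↦ S.φ y (X y)) x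
    - S.φ x (mlieBracket (𝓡 (2 * n + 1)) S.ξ X x))

/-- Almost cosymplectic: `dη = 0` and `dω = 0`. -/
def IsAlmostCosymplectic : Prop :=
  IsClosedOneForm S.η ∧ IsClosedTwoForm S.fundamentalForm

/-- The almost complex structure `J(X, s d/dt) = (φX - s ξ, η(X) d/dt)` on `M × ℝ`, where the
tangent space of `M × ℝ` at `(x, t)` is `T_x M × ℝ`. -/
def J (p : M × ℝ) (u : TangentSpace ((𝓡 (2 * n + 1)).prod 𝓘(ℝ, ℝ)) p) :
    TangentSpace ((𝓡 (2 * n + 1)).prod 𝓘(ℝ, ℝ)) p :=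
  letI v : TangentSpace (𝓡 (2 * n + 1)) p.1 := Prod.fst u
  letI s : ℝ := Prod.snd u
  (S.φ p.1 v - s • S.ξ p.1, S.η p.1 v)

/-- The almost contact structure is normal: the almost complex structure `J` on `M × ℝ` is
integrable, i.e. its Nijenhuis tensor `[JU, JV] - J[JU, V] - J[U, JV] - [U, V]` vanishes. -/
def IsNormal : Prop :=
  ∀ (p : M × ℝ) (U V : Π p : M × ℝ, TangentSpace ((𝓡 (2 * n + 1)).prod 𝓘(ℝ, ℝ)) p),
    DiffVectorFieldAt ((𝓡 (2 * n + 1)).prod 𝓘(ℝ, ℝ)) U p →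
    DiffVectorFieldAt ((𝓡 (2 * n + 1)).prod 𝓘(ℝ, ℝ)) V p →
      mlieBracket ((𝓡 (2 * n + 1)).prod 𝓘(ℝ, ℝ)) (fun q ↦ S.J q (U q)) (fun q ↦ S.J q (V q)) p
        - S.J p (mlieBracket ((𝓡 (2 * n + 1)).prod 𝓘(ℝ, ℝ)) (fun q ↦ S.J q (U q)) V p)
        - S.J p (mlieBracket ((𝓡 (2 * n + 1)).prod 𝓘(ℝ, ℝ)) U (fun q ↦ S.J q (V q)) p)
        - mlieBracket ((𝓡 (2 * n + 1)).prod 𝓘(ℝ, ℝ)) U V p = 0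

/-- Cosymplectic (coKähler): almost cosymplectic and normal. -/
def IsCosymplectic : Prop :=
  S.IsAlmostCosymplectic ∧ S.IsNormal

/-- The `(κ, μ)`-condition
`R(X, Y)ξ = κ (η(Y) X - η(X) Y) + μ (η(Y) hX - η(X) hY)` for all vector fields `X`, `Y`,
where `R` is the curvature of the Levi-Civita connection `nab`. -/
def IsKappaMu
    (nab : CovariantDerivative (𝓡 (2 * n + 1)) (EuclideanSpace ℝ (Fin (2 * n + 1)))
      (TangentSpace (𝓡 (2 * n + 1)) : M → Type _)) (κ μ : ℝ) : Prop :=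
  ∀ (x : M) (X Y : Π x : M, TangentSpace (𝓡 (2 * n + 1)) x),
    SmoothVectorFieldAt (𝓡 (2 * n + 1)) X x → SmoothVectorFieldAt (𝓡 (2 * n + 1)) Y x →
      curvature nab X Y S.ξ x =
        κ • (S.η x (Y x) • X x - S.η x (X x) • Y x)
          + μ • (S.η x (Y x) • S.h X x - S.η x (X x) • S.h Y x)

end AlmostContactMetricStructure

end

/-! The hypotheses force every vector field to be a multiple of `ξ`, so a nonempty `M` has dimension
one and the Einstein alternative holds with `c = 0`.

Write A for `∇ξ`, P for the projection to `ξᗮ`. Closedness of η and ω makes A symmetric with Aξ = 0,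
Aφ = -φA and `∇_ξ φ` = 0, so h = φA. The (κ, μ)-condition gives A² = -κP. As κ is invertible, so is
A on `ξᗮ`, and symmetry arguments then determine `∇A` (`covDerivEnd_covDeriv`) and `∇φ`
(`covDerivEnd_φ`). By the Ricci identities the intrinsic curvature of the leaves of ker η commutes
with A and φ. These anticommute, so the leaves are flat (`curv_horiz`), and the curvature of M is
explicit (`curv_eq`). Since A and φA have trace zero, Ric = 2nκ η⊗η + μ g(φA·, ·).

For a closed Weyl structure with Lee field U, Ric^D is Ric - (2n-1)(∇θ - θ⊗θ) up to a multiple of g.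
The Einstein–Weyl equation thus becomes ∇_X U = θ(X)U + aη(X)ξ + bφAX + σX with a = 2nκ/(2n-1), b =
μ/(2n-1) (`nab_dual_eq`). Its integrability condition is R(X,Y)U, computed by differentiation,
against the known curvature (`horiz_eq_zero_of_nab_eq`). For μ ≠ 0 the ξ-component of R(X,φX)U gives
κb|φX|² = 0. For μ = 0, R(X,ξ)U makes A a scalar on `ξᗮ`; anticommuting with φ, it vanishes, against
A² = -κP unless P = 0.

The tensor calculus is done over an abstract module of vector fields. Smooth fields on M form an
instance, and only Ricci traces are taken pointwise. -/

noncomputable section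

/-! ### Abstract Riemannian calculus and the symmetries of curvature -/

/-- The algebraic skeleton of Riemannian geometry: the `C`-module `𝔛` of vector fields acts on the
algebra `C` of functions by derivations, with a metric and its torsion-free metric connection.
The bracket of `X` and `Y` is `nab X Y - nab Y X`. -/
structure RiemannianCalculus (C 𝔛 : Type*) [CommRing C] [Algebra ℝ C] [AddCommGroup 𝔛]
    [Module C 𝔛] where
  der : 𝔛 →ₗ[C] Derivation ℝ C C
  g : 𝔛 →ₗ[C] 𝔛 →ₗ[C] C
  nab : 𝔛 →ₗ[C] 𝔛 →+ 𝔛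
  g_symm : ∀ X Y, g X Y = g Y X
  g_definite : ∀ X, g X X = 0 → X = 0
  leibniz : ∀ X (f : C) Y, nab X (f • Y) = f • nab X Y + der X f • Y
  metric : ∀ X Y Z, der X (g Y Z) = g (nab X Y) Z + g Y (nab X Z)
  der_bracket : ∀ X Y f, der (nab X Y - nab Y X) f = der X (der Y f) - der Y (der X f)
  bianchi : ∀ X Y Z,
    (nab X (nab Y Z) - nab Y (nab X Z) - nab (nab X Y - nab Y X) Z)
    + (nab Y (nab Z X) - nab Z (nab Y X) - nab (nab Y Z - nab Z Y) X)
    + (nab Z (nab X Y) - nab X (nab Z Y) - nab (nab Z X - nab X Z) Y) = 0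

namespace RiemannianCalculus

variable {C 𝔛 : Type*} [CommRing C] [Algebra ℝ C] [AddCommGroup 𝔛] [Module C 𝔛]
  (K : RiemannianCalculus C 𝔛)

/-- The curvature. -/
def curv (X Y Z : 𝔛) : 𝔛 :=
  K.nab X (K.nab Y Z) - K.nab Y (K.nab X Z) - K.nab (K.nab X Y - K.nab Y X) Z

lemma two_cancel {a : C} (h : 2 * a = 0) : a = 0 := by
  have h2 : algebraMap ℝ C 2⁻¹ * 2 = 1 := by
    rw [← map_ofNat (algebraMap ℝ C) 2, ← map_mul]; norm_num
  linear_combination algebraMap ℝ C 2⁻¹ * h - a * h2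

lemma eq_zero_of_forall {X : 𝔛} (h : ∀ Z, K.g X Z = 0) : X = 0 := K.g_definite X (h X)

lemma eq_of_forall {X Y : 𝔛} (h : ∀ Z, K.g X Z = K.g Y Z) : X = Y := by
  rw [← sub_eq_zero]
  exact K.eq_zero_of_forall fun Z ↦ by simp [h Z]

lemma curv_swap (X Y Z : 𝔛) : K.curv Y X Z = -K.curv X Y Z := by
  simp only [curv, map_sub, AddMonoidHom.sub_apply]; abel

lemma curv_cyclic (X Y Z : 𝔛) : K.curv X Y Z + K.curv Y Z X + K.curv Z X Y = 0 :=
  K.bianchi X Y Z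

lemma curv_smul_left (f : C) (X Y Z : 𝔛) : K.curv (f • X) Y Z = f • K.curv X Y Z := by
  simp only [curv, map_sub, map_smul, AddMonoidHom.sub_apply, AddMonoidHom.smul_apply, K.leibniz,
    map_add, AddMonoidHom.add_apply]
  module

lemma curv_metric (X Y Z W : 𝔛) : K.g (K.curv X Y Z) W = -K.g (K.curv X Y W) Z := by
  have h := K.der_bracket X Y (K.g Z W)
  simp only [K.metric, map_add] at h
  have s1 := K.g_symm (K.nab X (K.nab Y W)) Z
  have s2 := K.g_symm (K.nab Y (K.nab X W)) Z
  have s3 := K.g_symm (K.nab (K.nab X Y - K.nab Y X) W) Z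
  simp only [curv, map_sub, LinearMap.sub_apply] at *
  linear_combination -h + s1 - s2 - s3

/-- The usual octahedron argument: a signed sum of four Bianchi identities, simplified by the two
skew-symmetries. -/
lemma curv_pair (X Y Z W : 𝔛) : K.g (K.curv X Y Z) W = K.g (K.curv Z W X) Y := by
  have b (X Y Z W : 𝔛) :
      K.g (K.curv X Y Z) W + K.g (K.curv Y Z X) W + K.g (K.curv Z X Y) W = 0 := by
    rw [← LinearMap.add_apply, ← LinearMap.add_apply, ← map_add, ← map_add, K.curv_cyclic]; simp
  have a (X Y Z W : 𝔛) : K.g (K.curv X Y Z) W = -K.g (K.curv Y X Z) W := by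
    rw [K.curv_swap X Y]; simp
  have m := K.curv_metric
  rw [← sub_eq_zero]
  apply two_cancel
  linear_combination b X Y Z W + b Y Z W X - b Z W X Y - b W X Y Z - m Y Z W X - m Z W Y X
    - a W Y Z X + a W X Z Y - m X W Z Y + a X Z W Y - m Z X W Y + a W X Y Z + m X Y W Z + m Y W X Z

end RiemannianCalculus

/-! ### Almost cosymplectic structures: `∇ξ`, φ and their commutation -/

/-- An almost cosymplectic `(κ, μ)`-structure with invertible `κ`, in algebraic form. The dual
1-form of `ξ` is `X ↦ g X ξ`. -/
structure RiemannianCalculus.IsAlmostCosymplecticKappaMu {C 𝔛 : Type*} [CommRing C] [Algebra ℝ C]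
    [AddCommGroup 𝔛] [Module C 𝔛] (K : RiemannianCalculus C 𝔛) (φ : 𝔛 →ₗ[C] 𝔛) (ξ : 𝔛)
    (κ μ : C) : Prop where
  g_ξ_ξ : K.g ξ ξ = 1
  φ_φ : ∀ X, φ (φ X) = -X + K.g X ξ • ξ
  g_φ_ξ : ∀ X, K.g (φ X) ξ = 0
  φ_ξ : φ ξ = 0
  g_φ_φ : ∀ X Y, K.g (φ X) (φ Y) = K.g X Y - K.g X ξ * K.g Y ξ
  closed_η : ∀ X Y, K.der X (K.g Y ξ) - K.der Y (K.g X ξ) - K.g (K.nab X Y - K.nab Y X) ξ = 0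
  closed_ω : ∀ X Y Z, K.der X (K.g (φ Y) Z) - K.der Y (K.g (φ X) Z) + K.der Z (K.g (φ X) Y)
    - K.g (φ (K.nab X Y - K.nab Y X)) Z + K.g (φ (K.nab X Z - K.nab Z X)) Y
    - K.g (φ (K.nab Y Z - K.nab Z Y)) X = 0
  isUnit_κ : IsUnit κ
  der_κ : ∀ X, K.der X κ = 0
  der_μ : ∀ X, K.der X μ = 0
  two_curv_ξ : ∀ X Y, (2 : C) • K.curv X Y ξ =
    (2 * κ) • (K.g Y ξ • X - K.g X ξ • Y)
      + μ • (K.g Y ξ • (K.nab ξ (φ X) - K.nab (φ X) ξ - φ (K.nab ξ X - K.nab X ξ))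
        - K.g X ξ • (K.nab ξ (φ Y) - K.nab (φ Y) ξ - φ (K.nab ξ Y - K.nab Y ξ)))

namespace RiemannianCalculus

variable {C 𝔛 : Type*} [CommRing C] [Algebra ℝ C] [AddCommGroup 𝔛] [Module C 𝔛]
  (K : RiemannianCalculus C 𝔛)

lemma two_smul_cancel {X : 𝔛} (h : (2 : C) • X = 0) : X = 0 := by
  have h2 : algebraMap ℝ C 2⁻¹ * 2 = 1 := by
    rw [← map_ofNat (algebraMap ℝ C) 2, ← map_mul]; norm_num
  rw [← one_smul C X, ← h2, mul_smul, h, smul_zero]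

/-- The tensor `X ↦ ∇_X ξ`. -/
def covDeriv (ξ : 𝔛) : 𝔛 →ₗ[C] 𝔛 where
  toFun X := K.nab X ξ
  map_add' X Y := by simp
  map_smul' f X := by simp

lemma nab_eq_covDeriv (ξ X : 𝔛) : K.nab X ξ = K.covDeriv ξ X := rfl

lemma g_nab_ξ {ξ X Y : 𝔛} (hY : K.g Y ξ = 0) :
    K.g (K.nab X Y) ξ = -K.g Y (K.covDeriv ξ X) := by
  have h := K.metric X Y ξ
  rw [hY, map_zero, K.nab_eq_covDeriv ξ] at h
  linear_combination -h

/-- `(∇_X T) Y` for a `(1,1)`-tensor `T`. -/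
def covDerivEnd (T : 𝔛 →ₗ[C] 𝔛) (X Y : 𝔛) : 𝔛 := K.nab X (T Y) - T (K.nab X Y)

lemma nab_end (T : 𝔛 →ₗ[C] 𝔛) (X Y : 𝔛) :
    K.nab X (T Y) = K.covDerivEnd T X Y + T (K.nab X Y) := by simp [covDerivEnd]

lemma curv_eq_covDerivEnd (ξ X Y : 𝔛) : K.curv X Y ξ =
    K.covDerivEnd (K.covDeriv ξ) X Y - K.covDerivEnd (K.covDeriv ξ) Y X := by
  simp only [curv, covDerivEnd, K.nab_eq_covDeriv ξ, map_sub, AddMonoidHom.sub_apply]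
  abel

/-- The constant c treats symmetric tensors (c = 1) and skew ones (c = -1) together. -/
lemma g_covDerivEnd_of_symm {T : 𝔛 →ₗ[C] 𝔛} {c : C} (hc : ∀ X, K.der X c = 0)
    (hT : ∀ Y Z, K.g (T Y) Z = c * K.g Y (T Z)) (X Y Z : 𝔛) :
    K.g (K.covDerivEnd T X Y) Z = c * K.g Y (K.covDerivEnd T X Z) := by
  have h := congrArg (K.der X) (hT Y Z)
  simp only [K.metric, Derivation.leibniz, smul_eq_mul, hc] at h
  have h1 := hT (K.nab X Y) Z
  have h2 := hT Y (K.nab X Z)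
  simp only [covDerivEnd, map_sub, LinearMap.sub_apply]
  linear_combination h - h1 - h2

namespace IsAlmostCosymplecticKappaMu

variable {K} {φ : 𝔛 →ₗ[C] 𝔛} {ξ : 𝔛} {κ μ : C} (S : K.IsAlmostCosymplecticKappaMu φ ξ κ μ)

include S

lemma g_ξ_φ (X : 𝔛) : K.g ξ (φ X) = 0 := by rw [K.g_symm, S.g_φ_ξ]

lemma g_φ_left (X Y : 𝔛) : K.g (φ X) Y = -K.g X (φ Y) := by
  have h := S.g_φ_φ (φ X) Y
  simp only [S.φ_φ, S.g_φ_ξ, map_add, map_neg, map_smul, LinearMap.add_apply, LinearMap.neg_apply,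
    LinearMap.smul_apply, smul_eq_mul, S.g_ξ_φ] at h
  linear_combination -h

lemma g_covDeriv_symm (X Y : 𝔛) : K.g (K.covDeriv ξ X) Y = K.g X (K.covDeriv ξ Y) := by
  have h := S.closed_η X Y
  simp only [K.metric, map_sub, LinearMap.sub_apply, K.nab_eq_covDeriv ξ] at h
  rw [K.g_symm _ Y]
  linear_combination h

lemma g_covDeriv_ξ (X : 𝔛) : K.g (K.covDeriv ξ X) ξ = 0 := by
  have h := congrArg (K.der X) S.g_ξ_ξ
  simp only [K.metric, K.nab_eq_covDeriv ξ, Derivation.map_one_eq_zero, K.g_symm ξ] at h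
  exact two_cancel (by linear_combination h)

lemma covDeriv_ξ : K.covDeriv ξ ξ = 0 :=
  K.eq_zero_of_forall fun Z ↦ by rw [S.g_covDeriv_symm, K.g_symm, S.g_covDeriv_ξ]

lemma covDerivEnd_φ_ξ (X : 𝔛) : K.covDerivEnd φ X ξ = -φ (K.covDeriv ξ X) := by
  simp [covDerivEnd, S.φ_ξ, K.nab_eq_covDeriv ξ]

lemma g_covDerivEnd_φ (X Y Z : 𝔛) :
    K.g (K.covDerivEnd φ X Y) Z = -K.g Y (K.covDerivEnd φ X Z) := by
  have := K.g_covDerivEnd_of_symm (T := φ) (c := -1) (by simp)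
    (fun Y Z ↦ by rw [S.g_φ_left]; ring) X Y Z
  rw [this]; ring

lemma covDerivEnd_φ_φ (X Y : 𝔛) : K.covDerivEnd φ X (φ Y) =
    -φ (K.covDerivEnd φ X Y) + K.g Y (K.covDeriv ξ X) • ξ + K.g Y ξ • K.covDeriv ξ X := by
  simp only [covDerivEnd, S.φ_φ, map_add, map_neg, map_sub, K.leibniz, K.metric,
    K.nab_eq_covDeriv ξ]
  module

/-- For a torsion-free connection, dω is the cyclic sum of ∇ω. -/
lemma covDerivEnd_φ_cyclic (X Y Z : 𝔛) : K.g (K.covDerivEnd φ X Y) Z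
    + K.g (K.covDerivEnd φ Y Z) X + K.g (K.covDerivEnd φ Z X) Y = 0 := by
  have h := S.closed_ω X Y Z
  simp only [K.metric, covDerivEnd, map_sub, LinearMap.sub_apply] at *
  have e1 := S.g_φ_left (K.nab X Z) Y
  have e2 := S.g_φ_left (K.nab Y Z) X
  have e3 := S.g_φ_left X (K.nab Y Z)
  have e5 := congrArg (K.der Y) (S.g_φ_left X Z)
  simp only [K.metric, map_neg] at e5
  have e6 := K.g_symm (K.nab X Z) (φ Y)
  have e7 := K.g_symm (K.nab Y Z) (φ X)
  have e8 := K.g_symm X (K.nab Y (φ Z))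
  have e9 := S.g_φ_left (K.nab Y X) Z
  have e10 := K.g_symm (φ (K.nab Y Z)) X
  have e11 := S.g_φ_left X (K.nab Z Y)
  have e12 := K.g_symm (φ (K.nab Z Y)) X
  linear_combination h + e5 - e1 + e2 - e3 + e6 - e7 - e8 - e9 - e10 - e11 - e12

lemma covDeriv_φ_aux (Y : 𝔛) :
    K.covDerivEnd φ ξ Y = -(K.covDeriv ξ (φ Y) + φ (K.covDeriv ξ Y)) := by
  refine K.eq_of_forall fun Z ↦ ?_
  have h := S.covDerivEnd_φ_cyclic ξ Y Z
  rw [S.g_covDerivEnd_φ Y, S.covDerivEnd_φ_ξ, S.covDerivEnd_φ_ξ] at h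
  simp only [map_neg, map_add, LinearMap.neg_apply, LinearMap.add_apply] at *
  have e1 := S.g_φ_left (K.covDeriv ξ Z) Y
  have e2 := S.g_covDeriv_symm (φ Y) Z
  have e3 := K.g_symm (K.covDeriv ξ Z) (φ Y)
  have e4 := K.g_symm (φ (K.covDeriv ξ Y)) Z
  linear_combination h + e1 + e2 + e4 - e3

/-- Differentiating φ² = -I + η⊗ξ along ξ shows that `∇_ξ φ` anticommutes with φ, because Aξ = 0.
Inserting `∇_ξ φ` = -(Aφ + φA) leaves φAφ = A, and another φ gives the claim. -/
lemma covDeriv_φ (Y : 𝔛) : K.covDeriv ξ (φ Y) = -φ (K.covDeriv ξ Y) := by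
  have h := S.covDerivEnd_φ_φ ξ Y
  rw [S.covDeriv_φ_aux, S.covDeriv_φ_aux, S.covDeriv_ξ] at h
  simp only [S.φ_φ, map_add, map_neg, map_smul, S.covDeriv_ξ, S.g_covDeriv_ξ, map_zero] at h
  have h1 : φ (K.covDeriv ξ (φ Y)) = K.covDeriv ξ Y := by
    rw [← sub_eq_zero]
    refine two_smul_cancel (C := C) ?_
    linear_combination (norm := module) -h
  have h2 := congrArg φ h1
  rw [S.φ_φ, S.g_covDeriv_ξ] at h2
  linear_combination (norm := module) -h2

lemma covDerivEnd_φ_along_ξ (Y : 𝔛) : K.covDerivEnd φ ξ Y = 0 := by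
  rw [S.covDeriv_φ_aux, S.covDeriv_φ]; simp

end IsAlmostCosymplecticKappaMu
end RiemannianCalculus

/-! ### The (κ, μ)-condition and the covariant derivative of `∇ξ` -/

namespace RiemannianCalculus
namespace IsAlmostCosymplecticKappaMu

variable {C 𝔛 : Type*} [CommRing C] [Algebra ℝ C] [AddCommGroup 𝔛] [Module C 𝔛]
  {K : RiemannianCalculus C 𝔛} {φ : 𝔛 →ₗ[C] 𝔛} {ξ : 𝔛} {κ μ : C}
  (S : K.IsAlmostCosymplecticKappaMu φ ξ κ μ)

include S

/-- Since `∇_ξ φ` = 0 and A anticommutes with φ, the operator h of the (κ, μ)-condition is φA. -/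
lemma curv_ξ (X Y : 𝔛) : K.curv X Y ξ = κ • (K.g Y ξ • X - K.g X ξ • Y)
    + μ • (K.g Y ξ • φ (K.covDeriv ξ X) - K.g X ξ • φ (K.covDeriv ξ Y)) := by
  have h := S.two_curv_ξ X Y
  have hh (X : 𝔛) : K.nab ξ (φ X) - K.nab (φ X) ξ - φ (K.nab ξ X - K.nab X ξ)
      = (2 : C) • φ (K.covDeriv ξ X) := by
    rw [K.nab_eq_covDeriv ξ, K.nab_eq_covDeriv ξ, S.covDeriv_φ, K.nab_end, S.covDerivEnd_φ_along_ξ,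
      map_sub]
    module
  rw [hh, hh] at h
  rw [← sub_eq_zero]
  refine two_smul_cancel (C := C) ?_
  linear_combination (norm := module) h

lemma covDerivEnd_covDeriv_ξ (X : 𝔛) :
    K.covDerivEnd (K.covDeriv ξ) X ξ = -K.covDeriv ξ (K.covDeriv ξ X) := by
  simp [covDerivEnd, S.covDeriv_ξ, K.nab_eq_covDeriv ξ]

lemma g_covDerivEnd_covDeriv (X Y Z : 𝔛) :
    K.g (K.covDerivEnd (K.covDeriv ξ) X Y) Z = K.g Y (K.covDerivEnd (K.covDeriv ξ) X Z) := by
  have := K.g_covDerivEnd_of_symm (T := K.covDeriv ξ) (c := 1) (by simp)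
    (fun Y Z ↦ by rw [S.g_covDeriv_symm]; ring) X Y Z
  rw [this]; ring

lemma covDerivEnd_covDeriv_along_ξ_aux (Y : 𝔛) : K.covDerivEnd (K.covDeriv ξ) ξ Y =
    -K.covDeriv ξ (K.covDeriv ξ Y) + κ • (K.g Y ξ • ξ - Y) - μ • φ (K.covDeriv ξ Y) := by
  have h := K.curv_eq_covDerivEnd ξ ξ Y
  rw [S.curv_ξ, S.covDerivEnd_covDeriv_ξ, S.covDeriv_ξ, S.g_ξ_ξ, map_zero] at h
  linear_combination (norm := module) -h

/-- `∇_ξ A` anticommutes with φ, as A does and `∇_ξ φ` = 0. In the formula for `∇_ξ A` the φA term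
anticommutes with φ too, while A² + κP commutes with it, so that part vanishes. -/
lemma covDeriv_covDeriv (Y : 𝔛) :
    K.covDeriv ξ (K.covDeriv ξ Y) = -κ • (Y - K.g Y ξ • ξ) := by
  have h : K.covDerivEnd (K.covDeriv ξ) ξ (φ Y) + φ (K.covDerivEnd (K.covDeriv ξ) ξ Y) = 0 := by
    have h1 := congrArg (K.nab ξ) (S.covDeriv_φ Y)
    rw [map_neg, K.nab_end, K.nab_end, K.nab_end, K.nab_end, S.covDerivEnd_φ_along_ξ,
      S.covDerivEnd_φ_along_ξ, zero_add, S.covDeriv_φ, map_add] at h1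
    linear_combination (norm := module) h1
  simp only [S.covDerivEnd_covDeriv_along_ξ_aux, S.covDeriv_φ, map_add, map_neg, map_sub, map_smul,
    S.φ_φ, S.φ_ξ, S.g_φ_ξ, S.g_covDeriv_ξ] at h
  have h1 : φ (K.covDeriv ξ (K.covDeriv ξ Y)) = -κ • φ Y := by
    rw [← sub_eq_zero]
    refine two_smul_cancel (C := C) ?_
    linear_combination (norm := module) -h
  have h2 := congrArg φ h1
  rw [S.φ_φ, S.g_covDeriv_ξ, map_smul, S.φ_φ] at h2
  linear_combination (norm := module) -h2

lemma covDerivEnd_covDeriv_along_ξ (Y : 𝔛) :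
    K.covDerivEnd (K.covDeriv ξ) ξ Y = -μ • φ (K.covDeriv ξ Y) := by
  rw [S.covDerivEnd_covDeriv_along_ξ_aux, S.covDeriv_covDeriv]
  module

lemma g_φ_covDeriv_symm (X Y : 𝔛) :
    K.g (φ (K.covDeriv ξ X)) Y = K.g X (φ (K.covDeriv ξ Y)) := by
  rw [S.g_φ_left, S.g_covDeriv_symm, S.covDeriv_φ, map_neg, neg_neg]

lemma covDeriv_φ_covDeriv (X : 𝔛) : K.covDeriv ξ (φ (K.covDeriv ξ X)) = κ • φ X := by
  rw [S.covDeriv_φ, S.covDeriv_covDeriv, map_smul, map_sub, map_smul, S.φ_ξ]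
  module

/-- The derivative of A² = -κP. -/
lemma covDerivEnd_covDeriv_anti (X Y : 𝔛) :
    K.covDerivEnd (K.covDeriv ξ) X (K.covDeriv ξ Y) =
      -K.covDeriv ξ (K.covDerivEnd (K.covDeriv ξ) X Y)
      + κ • (K.g Y (K.covDeriv ξ X) • ξ + K.g Y ξ • K.covDeriv ξ X) := by
  simp only [covDerivEnd, map_sub, S.covDeriv_covDeriv]
  simp only [map_sub, map_neg, neg_smul, K.leibniz, K.metric, S.der_κ,
    K.nab_eq_covDeriv ξ]
  module

/-- The covariant derivative of `∇ξ`. -/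
lemma covDerivEnd_covDeriv (X Y : 𝔛) : K.covDerivEnd (K.covDeriv ξ) X Y =
    κ • (K.g X Y • ξ + K.g Y ξ • X - (2 * K.g X ξ * K.g Y ξ) • ξ)
      - (μ * K.g X ξ) • φ (K.covDeriv ξ Y) := by
  let F (X Y : 𝔛) : 𝔛 := K.covDerivEnd (K.covDeriv ξ) X Y -
    (κ • (K.g X Y • ξ + K.g Y ξ • X - (2 * K.g X ξ * K.g Y ξ) • ξ)
      - (μ * K.g X ξ) • φ (K.covDeriv ξ Y))
  have hs (X Y : 𝔛) : F X Y = F Y X := by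
    have h := K.curv_eq_covDerivEnd ξ X Y
    rw [S.curv_ξ] at h
    simp only [F, K.g_symm Y X]
    linear_combination (norm := module) -h
  have hg (X Y Z : 𝔛) : K.g (F X Y) Z = K.g Y (F X Z) := by
    simp only [F, map_sub, map_add, map_smul, LinearMap.sub_apply, LinearMap.add_apply,
      LinearMap.smul_apply, smul_eq_mul, S.g_covDerivEnd_covDeriv, S.g_φ_covDeriv_symm,
      K.g_symm ξ, K.g_symm Y X]
    ring
  have ha (X Y : 𝔛) : F X (K.covDeriv ξ Y) = -K.covDeriv ξ (F X Y) := by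
    have e : K.g Y (K.covDeriv ξ X) = K.g X (K.covDeriv ξ Y) := by
      rw [← S.g_covDeriv_symm, K.g_symm]
    simp only [F, S.covDerivEnd_covDeriv_anti, map_sub, map_add, map_smul, S.covDeriv_ξ,
      S.g_covDeriv_ξ, S.covDeriv_φ_covDeriv, S.covDeriv_covDeriv, S.φ_ξ, e]
    module
  have hc (X Y Z : 𝔛) : K.g (F X (K.covDeriv ξ Y)) Z = -K.g (F X Y) (K.covDeriv ξ Z) := by
    rw [ha, map_neg, LinearMap.neg_apply, S.g_covDeriv_symm]
  -- The trilinear expression g(F X Y, Z) is totally symmetric, and moving A from one slot to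
  -- another changes its sign. Going round three slots is an odd number of moves, so any value with
  -- an A in it is zero.
  have h0 (X Y Z : 𝔛) : K.g (F (K.covDeriv ξ X) Y) Z = 0 := by
    have c1 (Y Z : 𝔛) : K.g (F (K.covDeriv ξ X) Y) Z = -K.g (F X Y) (K.covDeriv ξ Z) := by
      rw [hs, hc, hs]
    have c2 : K.g (F (K.covDeriv ξ X) Y) Z = -K.g (F X (K.covDeriv ξ Y)) Z := by
      rw [hg, K.g_symm, c1, hg, K.g_symm]
    exact two_cancel (by linear_combination c1 Y Z + c2 - hc X Y Z)
  have hξ (Y : 𝔛) : F ξ Y = 0 := by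
    simp only [F, S.covDerivEnd_covDeriv_along_ξ, S.g_ξ_ξ, K.g_symm ξ Y]
    module
  -- F vanishes on ξ, and on `ξᗮ` every vector is in the image of A, because A² = -κP with κ
  -- invertible.
  have hF : F X Y = 0 := by
    refine K.eq_zero_of_forall fun Z ↦ ?_
    have h := h0 (K.covDeriv ξ Y) X Z
    rw [hs, S.covDeriv_covDeriv] at h
    have e : F X (-κ • (Y - K.g Y ξ • ξ)) = -κ • F X Y + (κ * K.g Y ξ) • F X ξ := by
      simp only [F, covDerivEnd, map_sub, map_add, map_smul, K.leibniz, neg_smul, map_neg,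
        LinearMap.sub_apply,
        LinearMap.smul_apply, LinearMap.neg_apply, S.der_κ, K.metric, S.g_ξ_ξ, smul_eq_mul,
        K.nab_eq_covDeriv ξ]
      module
    rw [e, hs X ξ, hξ, smul_zero, add_zero, map_smul, LinearMap.smul_apply, smul_eq_mul] at h
    obtain ⟨u, hu⟩ := S.isUnit_κ
    rw [← hu, neg_mul, neg_eq_zero] at h
    exact (Units.mul_right_eq_zero u).1 h
  exact sub_eq_zero.1 hF

end IsAlmostCosymplecticKappaMu
end RiemannianCalculus

/-! ### The covariant derivative of φ -/

namespace RiemannianCalculus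
namespace IsAlmostCosymplecticKappaMu

variable {C 𝔛 : Type*} [CommRing C] [Algebra ℝ C] [AddCommGroup 𝔛] [Module C 𝔛]
  {K : RiemannianCalculus C 𝔛} {φ : 𝔛 →ₗ[C] 𝔛} {ξ : 𝔛} {κ μ : C}
  (S : K.IsAlmostCosymplecticKappaMu φ ξ κ μ)

include S

lemma κ_cancel {a : C} (h : κ * a = 0) : a = 0 := by
  obtain ⟨u, hu⟩ := S.isUnit_κ
  rw [← hu] at h
  exact (Units.mul_right_eq_zero u).1 h

/-- The leaves of `ker η` are Kähler. -/
lemma covDerivEnd_φ (X Y : 𝔛) : K.covDerivEnd φ X Y =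
    K.g (φ (K.covDeriv ξ X)) Y • ξ - K.g Y ξ • φ (K.covDeriv ξ X) := by
  let F (X Y : 𝔛) : 𝔛 := K.covDerivEnd φ X Y -
    (K.g (φ (K.covDeriv ξ X)) Y • ξ - K.g Y ξ • φ (K.covDeriv ξ X))
  have hs (X Y Z : 𝔛) : K.g (F X Y) Z = -K.g (F X Z) Y := by
    simp only [F, map_sub, map_smul, LinearMap.sub_apply, LinearMap.smul_apply, smul_eq_mul,
      S.g_covDerivEnd_φ X Y Z, K.g_symm ξ, K.g_symm Y (K.covDerivEnd φ X Z)]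
    ring
  have hc (X Y Z : 𝔛) : K.g (F X Y) Z + K.g (F Y Z) X + K.g (F Z X) Y = 0 := by
    have h := S.covDerivEnd_φ_cyclic X Y Z
    have e1 : K.g (φ (K.covDeriv ξ Y)) X = K.g (φ (K.covDeriv ξ X)) Y := by
      rw [S.g_φ_covDeriv_symm, K.g_symm]
    have e2 : K.g (φ (K.covDeriv ξ Z)) X = K.g (φ (K.covDeriv ξ X)) Z := by
      rw [S.g_φ_covDeriv_symm, K.g_symm]
    have e3 : K.g (φ (K.covDeriv ξ Z)) Y = K.g (φ (K.covDeriv ξ Y)) Z := by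
      rw [S.g_φ_covDeriv_symm, K.g_symm]
    simp only [F, map_sub, map_smul, LinearMap.sub_apply, LinearMap.smul_apply, smul_eq_mul,
      K.g_symm ξ, e1, e2, e3]
    linear_combination h
  -- Obtained by differentiating Aφ = -φA, with `∇A` known.
  have hA (X Y : 𝔛) : F X (K.covDeriv ξ Y) = -K.covDeriv ξ (F X Y) := by
    have h1 : K.nab X (K.covDeriv ξ (φ Y)) = -K.nab X (φ (K.covDeriv ξ Y)) := by
      rw [S.covDeriv_φ, map_neg]
    rw [K.nab_end (K.covDeriv ξ), K.nab_end φ, K.nab_end φ, K.nab_end (K.covDeriv ξ)] at h1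
    simp only [map_add, S.covDeriv_φ, S.covDerivEnd_covDeriv, S.g_φ_ξ,
      map_sub, map_smul, S.φ_ξ, S.φ_φ, S.g_covDeriv_ξ, map_neg] at h1
    have e : K.g X (φ Y) = -K.g (φ X) Y := by rw [S.g_φ_left, neg_neg]
    have e2 : K.g (φ (K.covDeriv ξ X)) (K.covDeriv ξ Y) = κ * K.g (φ X) Y := by
      rw [← S.g_covDeriv_symm, S.covDeriv_φ_covDeriv, map_smul, LinearMap.smul_apply, smul_eq_mul]
    simp only [F, map_sub, map_smul, S.covDeriv_ξ, S.g_covDeriv_ξ, S.covDeriv_φ_covDeriv, e2]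
    rw [e] at h1
    linear_combination (norm := module) h1
  have hφ (X Y : 𝔛) : F X (φ Y) = -φ (F X Y) := by
    have e : K.g (φ (K.covDeriv ξ X)) (φ Y) = K.g Y (K.covDeriv ξ X) := by
      rw [S.g_φ_φ, S.g_covDeriv_ξ, K.g_symm]; ring
    simp only [F, S.covDerivEnd_φ_φ, map_sub, map_smul, S.φ_ξ, S.φ_φ, S.g_covDeriv_ξ, S.g_φ_ξ, e]
    module
  have hF1 (X : 𝔛) : F X ξ = 0 := by
    simp only [F, S.covDerivEnd_φ_ξ, S.g_φ_ξ, S.g_ξ_ξ]; module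
  have hA3 (X Y Z : 𝔛) : K.g (F X (K.covDeriv ξ Y)) Z = -K.g (F X Y) (K.covDeriv ξ Z) := by
    rw [hA, map_neg, LinearMap.neg_apply, S.g_covDeriv_symm]
  have hφ3 (X Y Z : 𝔛) : K.g (F X (φ Y)) Z = K.g (F X Y) (φ Z) := by
    rw [hφ, map_neg, LinearMap.neg_apply, S.g_φ_left, neg_neg]
  have hAA (X Y Z : 𝔛) :
      K.g (F X (K.covDeriv ξ Y)) (K.covDeriv ξ Z) = κ * K.g (F X Y) Z := by
    rw [hA3, S.covDeriv_covDeriv, map_smul, map_sub, map_smul, hs X Y ξ, hF1]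
    simp
  -- U is symmetric in Y, Z, whereas g(F X Y, Z) is skew there. It remains to prove that U equals κ
  -- g(F X Y, Z), that is, N = 0.
  let U (X Y Z : 𝔛) : C := K.g (F (K.covDeriv ξ X) (K.covDeriv ξ Y)) Z
  have hU (X Y Z : 𝔛) : U X Y Z = U X Z Y := by
    simp only [U]; rw [hs, hA3]
  have hξ (X Y : 𝔛) : K.g (F X Y) ξ = 0 := by rw [hs, hF1]; simp
  have h1 (X Y Z : 𝔛) : U X Y Z - U Y Z X + κ * K.g (F Z X) Y = 0 := by
    have h := hc (K.covDeriv ξ X) (K.covDeriv ξ Y) Z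
    rw [hAA] at h
    have h' := hA3 (K.covDeriv ξ Y) Z X
    simp only [U]
    linear_combination h - h'
  let N (X Y Z : 𝔛) : C := -κ * K.g (F X Y) Z + U X Y Z
  have hN1 (X Y Z : 𝔛) : N X Y Z = N Y X Z := by
    simp only [N]
    linear_combination h1 X Y Z - κ * hc X Y Z + κ * hs Y X Z - hU Y X Z
  have hN2 (X Y Z : 𝔛) : N X Y (φ Z) = -N X Z (φ Y) := by
    have e1 : K.g (F X Y) (φ Z) = -K.g (F X Z) (φ Y) := by rw [← hφ3, hs]
    have e2 : U X Y (φ Z) = -U X Z (φ Y) := by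
      simp only [U]
      rw [← hφ3, ← neg_neg (φ (K.covDeriv ξ Y)), ← S.covDeriv_φ, hs, map_neg, hs, neg_neg, hA3, hs,
        neg_neg]
    simp only [N]
    linear_combination -κ * e1 + e2
  -- N(X, Y, φZ) is symmetric in X, Y by `hN1` and skew in Y, Z by `hN2`. Such a trilinear
  -- expression is zero.
  have hN3 (X Y Z : 𝔛) : N X Y (φ Z) = 0 := two_cancel (by
    linear_combination hN2 X Y Z - hN1 X Z (φ Y) - hN2 Z X Y + hN1 Z Y (φ X) + hN2 Y Z X
      - hN1 Y X (φ Z))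
  have hN (X Y Z : 𝔛) : N X Y Z = 0 := by
    have h := hN3 X Y (φ Z)
    simp only [N, U, S.φ_φ, map_add, map_neg, map_smul, hξ] at h
    simp only [N, U]
    linear_combination -h
  have hF : F X Y = 0 := K.eq_zero_of_forall fun Z ↦ S.κ_cancel <| two_cancel (by
    have e1 := hN X Y Z
    have e2 := hN X Z Y
    simp only [N] at e1 e2
    linear_combination e2 - e1 + hU X Y Z + κ * hs X Y Z)
  exact sub_eq_zero.1 hF

end IsAlmostCosymplecticKappaMu
end RiemannianCalculus

/-! ### Ricci identities for `∇ξ` and φ -/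

namespace RiemannianCalculus
namespace IsAlmostCosymplecticKappaMu

variable {C 𝔛 : Type*} [CommRing C] [Algebra ℝ C] [AddCommGroup 𝔛] [Module C 𝔛]
  {K : RiemannianCalculus C 𝔛} {φ : 𝔛 →ₗ[C] 𝔛} {ξ : 𝔛} {κ μ : C}
  (S : K.IsAlmostCosymplecticKappaMu φ ξ κ μ)

include S

lemma g_bracket_ξ {X Y : 𝔛} (hX : K.g X ξ = 0) (hY : K.g Y ξ = 0) :
    K.g (K.nab X Y) ξ = K.g (K.nab Y X) ξ := by
  have h := S.closed_η X Y
  rw [hX, hY, map_zero, map_zero, map_sub, LinearMap.sub_apply] at h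
  linear_combination -h

/-- Second covariant derivatives of A, antisymmetrized. For X, Y in ker η the bracket stays in ker
η, so the μ-terms of `∇A` drop out. -/
lemma curv_covDeriv {X Y : 𝔛} (hX : K.g X ξ = 0) (hY : K.g Y ξ = 0) (Z : 𝔛) :
    K.curv X Y (K.covDeriv ξ Z) = K.covDeriv ξ (K.curv X Y Z) +
      κ • (K.g Y Z • K.covDeriv ξ X + K.g Z (K.covDeriv ξ X) • Y
        - K.g X Z • K.covDeriv ξ Y - K.g Z (K.covDeriv ξ Y) • X) := by
  have hb := S.g_bracket_ξ hX hY
  simp only [curv, K.nab_end, S.covDerivEnd_covDeriv, map_add, map_sub, hX, hY,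
    AddMonoidHom.sub_apply, hb, mul_zero, zero_mul, zero_smul, sub_zero,
    K.leibniz, S.der_κ, add_zero, K.metric, K.nab_eq_covDeriv ξ]
  module

lemma curv_φ (X Y : 𝔛) {Z W : 𝔛} (hZ : K.g Z ξ = 0)
    (hW : K.g W ξ = 0) :
    K.g (K.curv X Y (φ Z)) W = K.g (φ (K.curv X Y Z)) W
      + K.g (φ (K.covDeriv ξ Y)) Z * K.g (K.covDeriv ξ X) W
      - K.g Z (K.covDeriv ξ X) * K.g (φ (K.covDeriv ξ Y)) W
      - K.g (φ (K.covDeriv ξ X)) Z * K.g (K.covDeriv ξ Y) W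
      + K.g Z (K.covDeriv ξ Y) * K.g (φ (K.covDeriv ξ X)) W := by
  have hW' : K.g ξ W = 0 := by rw [K.g_symm, hW]
  have hn (X : 𝔛) : K.g (K.nab X Z) ξ = -K.g Z (K.covDeriv ξ X) := K.g_nab_ξ hZ
  simp only [curv, K.nab_end φ, S.covDerivEnd_φ, map_add, map_sub, map_smul, hZ, hn,
    AddMonoidHom.sub_apply, LinearMap.sub_apply, LinearMap.add_apply, LinearMap.smul_apply,
    smul_eq_mul, hW', zero_smul, sub_zero, K.leibniz, K.nab_eq_covDeriv ξ, mul_zero]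
  ring

end IsAlmostCosymplecticKappaMu
end RiemannianCalculus

/-! ### Flatness of the leaves of ker η -/

namespace RiemannianCalculus

/-- A curvature-like tensor commuting with two anticommuting operators, one symmetric with square
`k` and one skew with square `-1`, vanishes. -/
lemma curvatureLike_eq_zero {C 𝔛 : Type*} [CommRing C] [Algebra ℝ C]
    {L : 𝔛 → 𝔛 → 𝔛 → 𝔛 → C} {A φ : 𝔛 → 𝔛} {k : C}
    (hk : ∀ a : C, k * a = 0 → a = 0)
    (h_cyclic : ∀ X Y Z W, L X Y Z W + L Y Z X W + L Z X Y W = 0)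
    (h_pair : ∀ X Y Z W, L X Y Z W = L Z W X Y)
    (hA : ∀ X Y Z W, L X Y (A Z) W = L X Y Z (A W))
    (hφ : ∀ X Y Z W, L X Y (φ Z) W = -L X Y Z (φ W))
    (hAA : ∀ X Y Z W, L X Y (A (A Z)) W = k * L X Y Z W)
    (hφφ : ∀ X Y Z W, L X Y (φ (φ Z)) W = -L X Y Z W)
    (hAφ : ∀ X Y Z W, L X Y (A (φ Z)) W = -L X Y (φ (A Z)) W) (X Y Z W : 𝔛) :
    L X Y Z W = 0 := by
  have hA' (X Y Z W : 𝔛) : L (A X) Y Z W = L X (A Y) Z W := by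
    rw [h_pair, hA, h_pair]
  have hAA' (X Y Z W : 𝔛) : L (A X) (A Y) Z W = k * L X Y Z W := by
    rw [h_pair, ← hA, hAA, h_pair]
  have h1 (X Y Z W : 𝔛) : k * L X Y Z W + L (A Y) Z (A X) W + L (A Z) X (A Y) W = 0 := by
    rw [← hAA', hA' Z]
    exact h_cyclic _ _ _ _
  -- Three cyclic instances of `h1` isolate a single term, modulo the Bianchi identity.
  have h2 (X Y Z W : 𝔛) : L (A X) Y (A Z) W = k * L X Y Z W := by
    rw [← sub_eq_zero]
    refine two_cancel ?_
    linear_combination h1 Y Z X W + h1 Z X Y W - h1 X Y Z W - k * h_cyclic X Y Z W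
  have h3 (X Y Z W : 𝔛) : L (A X) Y Z W = L X Y (A Z) W := by
    rw [← sub_eq_zero]
    refine hk _ ?_
    have := h2 X Y (A Z) W
    rw [hAA] at this
    linear_combination this
  -- By `h3` an A in the third slot may be moved to the first, where it does not interfere with φ.
  -- In the third slot A and φ anticommute. Comparing the two gives the term equal to its negative.
  have h4 (X Y Z W : 𝔛) : L X Y (A Z) W = 0 := by
    have e1 := hφ (A X) Y (φ Z) W
    have e2 := hφ X Y (φ (A Z)) W
    rw [hφφ] at e1 e2
    exact two_cancel (by
      linear_combination -h3 X Y Z W - e1 + h3 X Y (φ Z) (φ W) + hAφ X Y Z (φ W) - e2)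
  exact hk _ (by rw [← hAA, h4])

variable {C 𝔛 : Type*} [CommRing C] [Algebra ℝ C] [AddCommGroup 𝔛] [Module C 𝔛]
  (K : RiemannianCalculus C 𝔛)

/-- The projection to `ξᗮ`. -/
def horiz (ξ : 𝔛) : 𝔛 →ₗ[C] 𝔛 := LinearMap.id - (K.g.flip ξ).smulRight ξ

lemma horiz_apply (ξ X : 𝔛) : K.horiz ξ X = X - K.g X ξ • ξ := by simp [horiz]

lemma g_horiz (ξ X Y : 𝔛) : K.g (K.horiz ξ X) Y = K.g X (K.horiz ξ Y) := by
  simp [K.horiz_apply, K.g_symm ξ, mul_comm]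

namespace IsAlmostCosymplecticKappaMu

variable {K} {φ : 𝔛 →ₗ[C] 𝔛} {ξ : 𝔛} {κ μ : C} (S : K.IsAlmostCosymplecticKappaMu φ ξ κ μ)

include S

lemma g_horiz_ξ (X : 𝔛) : K.g (K.horiz ξ X) ξ = 0 := by
  simp [K.horiz_apply, S.g_ξ_ξ]

lemma covDeriv_horiz (X : 𝔛) : K.covDeriv ξ (K.horiz ξ X) = K.covDeriv ξ X := by
  simp [K.horiz_apply, S.covDeriv_ξ]

lemma horiz_covDeriv (X : 𝔛) : K.horiz ξ (K.covDeriv ξ X) = K.covDeriv ξ X := by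
  simp [K.horiz_apply, S.g_covDeriv_ξ]

lemma φ_horiz (X : 𝔛) : φ (K.horiz ξ X) = φ X := by
  simp [K.horiz_apply, S.φ_ξ]

lemma horiz_φ (X : 𝔛) : K.horiz ξ (φ X) = φ X := by
  simp [K.horiz_apply, S.g_φ_ξ]

lemma horiz_horiz (X : 𝔛) : K.horiz ξ (K.horiz ξ X) = K.horiz ξ X := by
  rw [K.horiz_apply _ (K.horiz ξ X), S.g_horiz_ξ]; simp

lemma covDeriv_covDeriv_eq_horiz (X : 𝔛) :
    K.covDeriv ξ (K.covDeriv ξ X) = -κ • K.horiz ξ X := by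
  rw [S.covDeriv_covDeriv, K.horiz_apply]

lemma g_covDeriv_horiz (X Y : 𝔛) :
    K.g (K.covDeriv ξ X) (K.horiz ξ Y) = K.g (K.covDeriv ξ X) Y := by
  simp [K.horiz_apply, S.g_covDeriv_ξ]

lemma φ_φ_eq_horiz (X : 𝔛) : φ (φ X) = -K.horiz ξ X := by
  rw [S.φ_φ, K.horiz_apply]; abel

/-- The leaves of `ker η` are flat. -/
lemma curv_horiz (X Y Z W : 𝔛) :
    K.g (K.curv (K.horiz ξ X) (K.horiz ξ Y) (K.horiz ξ Z)) (K.horiz ξ W) =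
      K.g (K.covDeriv ξ X) Z * K.g (K.covDeriv ξ Y) W
        - K.g (K.covDeriv ξ Y) Z * K.g (K.covDeriv ξ X) W := by
  -- By the Gauss equation L is the intrinsic curvature of the leaves, A being their shape operator
  -- up to sign. The corrections in `curv_covDeriv` and `curv_φ` are what makes L commute with A and
  -- φ.
  let L (X Y Z W : 𝔛) : C :=
    K.g (K.curv (K.horiz ξ X) (K.horiz ξ Y) (K.horiz ξ Z)) (K.horiz ξ W)
      - K.g (K.covDeriv ξ X) Z * K.g (K.covDeriv ξ Y) W
      + K.g (K.covDeriv ξ Y) Z * K.g (K.covDeriv ξ X) W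
  suffices h : L X Y Z W = 0 by
    simp only [L] at h
    linear_combination h
  have hs (X Y : 𝔛) : K.g (K.covDeriv ξ X) Y = K.g (K.covDeriv ξ Y) X := by
    rw [S.g_covDeriv_symm, K.g_symm]
  have hp := S.g_horiz_ξ
  refine curvatureLike_eq_zero (A := K.covDeriv ξ) (φ := φ) (k := -κ)
    ?_ ?_ ?_ ?_ ?_ ?_ ?_ ?_ ..
  · exact fun a ha ↦ S.κ_cancel (by linear_combination -ha)
  · intro X Y Z W
    have h := congrArg (fun V ↦ K.g V (K.horiz ξ W))
      (K.curv_cyclic (K.horiz ξ X) (K.horiz ξ Y) (K.horiz ξ Z))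
    simp only [map_add, LinearMap.add_apply, map_zero, LinearMap.zero_apply] at h
    simp only [L, hs Z X, hs Z Y, hs Y X]
    linear_combination h
  · intro X Y Z W
    simp only [L, K.curv_pair (K.horiz ξ X), hs Z, hs W]
    ring
  · intro X Y Z W
    have h := congrArg (fun V ↦ K.g V (K.horiz ξ W)) (S.curv_covDeriv (hp X) (hp Y) (K.horiz ξ Z))
    simp only [map_add, map_sub, map_smul, LinearMap.add_apply, LinearMap.sub_apply,
      LinearMap.smul_apply, smul_eq_mul, S.covDeriv_horiz, S.g_covDeriv_symm (K.curv _ _ _),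
      K.g_symm (K.horiz ξ Z) (K.covDeriv ξ _), S.g_covDeriv_horiz, ← K.g_horiz,
      S.horiz_horiz] at h
    have e (X Z : 𝔛) : K.g (K.covDeriv ξ X) (K.covDeriv ξ Z) = -κ * K.g (K.horiz ξ X) Z := by
      rw [← S.g_covDeriv_symm, S.covDeriv_covDeriv_eq_horiz, map_smul, LinearMap.smul_apply,
        smul_eq_mul]
    simp only [L, S.horiz_covDeriv, e]
    linear_combination h - K.g_horiz ξ (K.curv (K.horiz ξ X) (K.horiz ξ Y) (K.covDeriv ξ Z)) W
  · intro X Y Z W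
    have h := S.curv_φ (K.horiz ξ X) (K.horiz ξ Y) (hp Z) (hp W)
    simp only [S.φ_horiz, S.covDeriv_horiz, S.g_covDeriv_horiz, S.g_φ_left,
      K.g_symm (K.horiz ξ Z) (K.covDeriv ξ _)] at h
    simp only [L, S.horiz_φ]
    linear_combination h
  · intro X Y Z W
    have h1 := K.curv_pair (K.horiz ξ X)
    simp only [L, S.covDeriv_covDeriv_eq_horiz, map_smul, S.horiz_horiz, S.g_covDeriv_horiz]
    simp only [h1, K.curv_smul_left, map_smul, LinearMap.smul_apply, smul_eq_mul]
    ring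
  · intro X Y Z W
    have h1 := K.curv_pair (K.horiz ξ X)
    simp only [L, S.φ_φ_eq_horiz, ← neg_one_smul C (K.horiz ξ Z), map_smul, S.horiz_horiz,
      S.g_covDeriv_horiz]
    simp only [h1, K.curv_smul_left, map_smul, LinearMap.smul_apply, smul_eq_mul]
    ring
  · intro X Y Z W
    have h1 := K.curv_pair (K.horiz ξ X)
    simp only [L, S.covDeriv_φ, ← neg_one_smul C (φ _), map_smul]
    simp only [h1, K.curv_smul_left, map_smul, LinearMap.smul_apply, smul_eq_mul]
    ring

end IsAlmostCosymplecticKappaMu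
end RiemannianCalculus

/-! ### The full curvature tensor; closed Weyl connections -/

namespace RiemannianCalculus

variable {C 𝔛 : Type*} [CommRing C] [Algebra ℝ C] [AddCommGroup 𝔛] [Module C 𝔛]
  (K : RiemannianCalculus C 𝔛)

lemma curv_add_right (X Y Z Z' : 𝔛) : K.curv X Y (Z + Z') = K.curv X Y Z + K.curv X Y Z' := by
  simp only [curv, map_add]; abel

lemma curv_smul_right (f : C) (X Y Z : 𝔛) : K.curv X Y (f • Z) = f • K.curv X Y Z :=
  K.eq_of_forall fun W ↦ by
    rw [K.curv_pair, K.curv_smul_left, map_smul, map_smul, LinearMap.smul_apply,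
      LinearMap.smul_apply, ← K.curv_pair]

namespace IsAlmostCosymplecticKappaMu

variable {K} {φ : 𝔛 →ₗ[C] 𝔛} {ξ : 𝔛} {κ μ : C} (S : K.IsAlmostCosymplecticKappaMu φ ξ κ μ)

include S

/-- The curvature of an almost cosymplectic `(κ, μ)`-structure. -/
lemma curv_eq (X Y Z : 𝔛) : K.curv X Y Z =
    K.g (K.covDeriv ξ X) Z • K.covDeriv ξ Y - K.g (K.covDeriv ξ Y) Z • K.covDeriv ξ X
    + K.g Z ξ • (K.g Y ξ • (κ • K.horiz ξ X + μ • φ (K.covDeriv ξ X))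
        - K.g X ξ • (κ • K.horiz ξ Y + μ • φ (K.covDeriv ξ Y)))
    - (K.g Y ξ * (κ * K.g (K.horiz ξ X) Z + μ * K.g (φ (K.covDeriv ξ X)) Z)
        - K.g X ξ * (κ * K.g (K.horiz ξ Y) Z + μ * K.g (φ (K.covDeriv ξ Y)) Z)) • ξ := by
  have dec (X : 𝔛) : X = K.horiz ξ X + K.g X ξ • ξ := by rw [K.horiz_apply]; abel
  -- Splitting the last two arguments along ξ and `ξᗮ`, and then the first two by pair symmetry,
  -- leaves only the leafwise curvature and values of R(·,·)ξ.
  have split (X Y Z W : 𝔛) : K.g (K.curv X Y Z) W =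
      K.g (K.curv X Y (K.horiz ξ Z)) (K.horiz ξ W) - K.g W ξ * K.g (K.curv X Y ξ) Z
      + K.g Z ξ * K.g (K.curv X Y ξ) (K.horiz ξ W) := by
    conv_lhs => rw [dec W]
    rw [map_add, map_smul, smul_eq_mul, K.curv_metric X Y Z ξ]
    have h : K.curv X Y Z = K.curv X Y (K.horiz ξ Z) + K.g Z ξ • K.curv X Y ξ := by
      rw [← K.curv_smul_right, ← K.curv_add_right, ← dec]
    rw [h, map_add, map_smul, LinearMap.add_apply, LinearMap.smul_apply, smul_eq_mul]
    ring
  have h0 (X Y : 𝔛) : K.curv (K.horiz ξ X) (K.horiz ξ Y) ξ = 0 := by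
    rw [S.curv_ξ, S.g_horiz_ξ, S.g_horiz_ξ]; module
  have hM (X : 𝔛) : K.g (φ (K.covDeriv ξ X)) ξ = 0 := S.g_φ_ξ _
  refine K.eq_of_forall fun W ↦ ?_
  rw [split, K.curv_pair X Y, split (K.horiz ξ Z), h0, S.curv_horiz, S.curv_ξ]
  have e1 : K.g (K.covDeriv ξ Z) X = K.g (K.covDeriv ξ X) Z := by
    rw [S.g_covDeriv_symm, K.g_symm]
  have e2 : K.g (K.covDeriv ξ Z) Y = K.g (K.covDeriv ξ Y) Z := by
    rw [S.g_covDeriv_symm, K.g_symm]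
  have e3 : K.g (K.covDeriv ξ W) X = K.g (K.covDeriv ξ X) W := by
    rw [S.g_covDeriv_symm, K.g_symm]
  have e4 : K.g (K.covDeriv ξ W) Y = K.g (K.covDeriv ξ Y) W := by
    rw [S.g_covDeriv_symm, K.g_symm]
  simp only [map_add, map_sub, map_smul, map_zero, LinearMap.zero_apply, LinearMap.add_apply,
    LinearMap.sub_apply, LinearMap.smul_apply, smul_eq_mul, K.horiz_apply, hM,
    K.g_symm ξ, e1, e2, e3, e4]
  ring

end IsAlmostCosymplecticKappaMu

/-- A torsion-free connection `D` with `D g = -2 θ ⊗ g` for a closed 1-form `θ`. -/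
structure IsClosedWeyl (D : 𝔛 →ₗ[C] 𝔛 →+ 𝔛) (θ : 𝔛 →ₗ[C] C) : Prop where
  leibniz : ∀ X (f : C) Y, D X (f • Y) = f • D X Y + K.der X f • Y
  torsion_free : ∀ X Y, D X Y - D Y X = K.nab X Y - K.nab Y X
  metric : ∀ X Y Z, K.der X (K.g Y Z) - K.g (D X Y) Z - K.g Y (D X Z) = -2 * θ X * K.g Y Z
  closed : ∀ X Y, K.der X (θ Y) - K.der Y (θ X) - θ (K.nab X Y - K.nab Y X) = 0

namespace IsClosedWeyl

variable {K} {D : 𝔛 →ₗ[C] 𝔛 →+ 𝔛} {θ : 𝔛 →ₗ[C] C} (W : K.IsClosedWeyl D θ)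

include W

/-- The Koszul argument: the difference D - ∇ is symmetric in X, Y, and its symmetrization in Y, Z
is 2θ(X)g(Y, Z). -/
lemma g_sub (X Y Z : 𝔛) : K.g (D X Y - K.nab X Y) Z =
    θ X * K.g Y Z + θ Y * K.g X Z - θ Z * K.g X Y := by
  have m (X Y Z : 𝔛) : K.g (D X Y - K.nab X Y) Z + K.g (D X Z - K.nab X Z) Y
      = 2 * θ X * K.g Y Z := by
    have h := W.metric X Y Z
    rw [K.metric] at h
    simp only [map_sub, LinearMap.sub_apply, K.g_symm Y] at *
    linear_combination -h
  have t (X Y Z : 𝔛) : K.g (D X Y - K.nab X Y) Z = K.g (D Y X - K.nab Y X) Z := by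
    have h := congrArg (fun V ↦ K.g V Z) (W.torsion_free X Y)
    simp only [map_sub, LinearMap.sub_apply] at *
    linear_combination h
  rw [← sub_eq_zero]
  apply two_cancel
  linear_combination m X Y Z + m Y X Z - m Z X Y + t X Y Z - t X Z Y - t Y Z X

/-- The metric dual of the Lee form, as a vector field. -/
lemma exists_dual {ξ : 𝔛} (hξ : K.g ξ ξ = 1) : ∃ U : 𝔛, ∀ Z, K.g U Z = θ Z := by
  -- `g_sub` at (ξ, ξ) reads D_ξ ξ - ∇_ξ ξ = 2θ(ξ)ξ - U for the sought dual U.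
  refine ⟨(2 * θ ξ) • ξ - (D ξ ξ - K.nab ξ ξ), fun Z ↦ ?_⟩
  have h := W.g_sub ξ ξ Z
  rw [hξ] at h
  rw [map_sub, LinearMap.sub_apply, h, map_smul, LinearMap.smul_apply, smul_eq_mul]
  ring

lemma apply_eq {U : 𝔛} (hU : ∀ Z, K.g U Z = θ Z) (X Y : 𝔛) :
    D X Y = K.nab X Y + θ X • Y + θ Y • X - K.g X Y • U := by
  have : D X Y - K.nab X Y = θ X • Y + θ Y • X - K.g X Y • U := K.eq_of_forall fun Z ↦ by
    rw [W.g_sub]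
    simp only [map_sub, map_add, map_smul, LinearMap.sub_apply, LinearMap.add_apply,
      LinearMap.smul_apply, smul_eq_mul, hU]
    ring
  rw [sub_eq_iff_eq_add'] at this
  rw [this]; abel

lemma g_nab_dual {U : 𝔛} (hU : ∀ Z, K.g U Z = θ Z) (X Y : 𝔛) :
    K.g (K.nab X U) Y = K.g (K.nab Y U) X := by
  have h := W.closed X Y
  rw [← hU, ← hU, ← hU, K.metric, K.metric, map_sub] at h
  linear_combination h

/-- The curvature of a closed Weyl connection. -/
lemma curv_eq {U : 𝔛} (hU : ∀ Z, K.g U Z = θ Z) (X Y Z : 𝔛) :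
    D X (D Y Z) - D Y (D X Z) - D (K.nab X Y - K.nab Y X) Z =
      K.curv X Y Z + (K.g (K.nab X U) Z - θ X * θ Z) • Y - (K.g (K.nab Y U) Z - θ Y * θ Z) • X
      - K.g Y Z • (K.nab X U - θ X • U) + K.g X Z • (K.nab Y U - θ Y • U)
      - θ U • (K.g Y Z • X - K.g X Z • Y) := by
  have hs : K.g Y (K.nab X U) = K.g X (K.nab Y U) := by
    rw [K.g_symm, W.g_nab_dual hU, K.g_symm]
  simp only [W.apply_eq hU, curv, map_add, map_sub, map_smul, K.leibniz, AddMonoidHom.sub_apply,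
    LinearMap.sub_apply, LinearMap.add_apply, LinearMap.smul_apply, smul_eq_mul, ← hU, K.metric,
    K.g_symm U, hs, K.g_symm Y X,
    K.g_symm Z (K.nab _ _)]
  simp only [hU]
  module

end IsClosedWeyl
end RiemannianCalculus

/-! ### Integrability of the equation for the Lee field -/

namespace RiemannianCalculus
namespace IsAlmostCosymplecticKappaMu

variable {C 𝔛 : Type*} [CommRing C] [Algebra ℝ C] [AddCommGroup 𝔛] [Module C 𝔛]
  {K : RiemannianCalculus C 𝔛} {φ : 𝔛 →ₗ[C] 𝔛} {ξ : 𝔛} {κ μ : C}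
  (S : K.IsAlmostCosymplecticKappaMu φ ξ κ μ) {θ : 𝔛 →ₗ[C] C} {U : 𝔛} {a b σ : C}

include S

lemma horiz_eq_zero_of_φ {X : 𝔛} (h : φ X = 0) : K.horiz ξ X = 0 := by
  have h1 := S.φ_φ_eq_horiz X
  rw [h, map_zero] at h1
  linear_combination (norm := module) h1

/-- Differentiate the equation for ∇U and antisymmetrize. The derivative of θ disappears because θ
is closed, and those of A and φ are known. -/
lemma curv_of_nab_eq
    (hθ : ∀ X Y, K.der X (θ Y) - K.der Y (θ X) - θ (K.nab X Y - K.nab Y X) = 0)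
    (ha : ∀ X, K.der X a = 0) (hb : ∀ X, K.der X b = 0)
    (h : ∀ X, K.nab X U = θ X • U + (a * K.g X ξ) • ξ + b • φ (K.covDeriv ξ X) + σ • X)
    (X Y : 𝔛) : K.curv X Y U =
      θ Y • K.nab X U - θ X • K.nab Y U + a • (K.g Y ξ • K.covDeriv ξ X - K.g X ξ • K.covDeriv ξ Y)
      + b • ((2 * κ * K.g (φ X) Y) • ξ + κ • (K.g Y ξ • φ X - K.g X ξ • φ Y)
        + μ • (K.g X ξ • K.covDeriv ξ Y - K.g Y ξ • K.covDeriv ξ X))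
      + K.der X σ • Y - K.der Y σ • X := by
  have e1 : K.g Y (K.covDeriv ξ X) = K.g X (K.covDeriv ξ Y) := by
    rw [← S.g_covDeriv_symm, K.g_symm]
  have e2 (X Y : 𝔛) : K.g (φ (K.covDeriv ξ X)) (K.covDeriv ξ Y) = κ * K.g (φ X) Y := by
    rw [← S.g_covDeriv_symm, S.covDeriv_φ_covDeriv, map_smul, LinearMap.smul_apply, smul_eq_mul]
  have e3 : K.g (φ Y) X = -K.g (φ X) Y := by rw [S.g_φ_left, K.g_symm]
  have hθ' := hθ X Y
  rw [map_sub] at hθ'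
  have hθ'' : K.der X (θ Y) = K.der Y (θ X) + θ (K.nab X Y) - θ (K.nab Y X) := by
    linear_combination hθ'
  simp only [curv, h, map_add, map_sub, map_smul, K.leibniz, K.nab_end, S.covDerivEnd_φ,
    S.covDerivEnd_covDeriv, AddMonoidHom.sub_apply, Derivation.leibniz,
    smul_eq_mul, ha, hb, K.metric, K.nab_eq_covDeriv ξ, e1, e2, e3, S.g_covDeriv_ξ, S.φ_φ, S.φ_ξ,
    hθ'']
  module

/-- If the dual `U` of a closed form satisfies the equation that a closed Einstein–Weyl structure
imposes on it, then all vector fields are multiples of `ξ`. -/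
theorem horiz_eq_zero_of_nab_eq (hU : ∀ Z, K.g U Z = θ Z)
    (hθ : ∀ X Y, K.der X (θ Y) - K.der Y (θ X) - θ (K.nab X Y - K.nab Y X) = 0)
    (ha : ∀ X, K.der X a = 0) (hb : ∀ X, K.der X b = 0) (hau : IsUnit a)
    (hbμ : IsUnit b ∨ b = 0 ∧ μ = 0)
    (h : ∀ X, K.nab X U = θ X • U + (a * K.g X ξ) • ξ + b • φ (K.covDeriv ξ X) + σ • X)
    (X : 𝔛) : K.horiz ξ X = 0 := by
  have cancel {u : C} (hu : IsUnit u) {v : C} (h : u * v = 0) : v = 0 := by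
    obtain ⟨u, rfl⟩ := hu
    exact (Units.mul_right_eq_zero u).1 h
  have cancel' {u : C} (hu : IsUnit u) {V : 𝔛} (h : u • V = 0) : V = 0 := by
    obtain ⟨u, rfl⟩ := hu
    rw [← one_smul C V, ← u.inv_mul, mul_smul, h, smul_zero]
  have hc := S.curv_of_nab_eq hθ ha hb h
  rcases hbμ with hb' | ⟨rfl, rfl⟩
  -- The (κ, μ)-condition makes g(R(PX, φX)U, ξ) zero, while the integrability formula evaluates it
  -- to 2κb g(φX, φX).
  · apply S.horiz_eq_zero_of_φ
    refine K.g_definite _ ?_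
    have h1 := congrArg (fun V ↦ K.g V ξ) (hc (K.horiz ξ X) (φ X))
    have h2 : K.g (K.curv (K.horiz ξ X) (φ X) U) ξ = 0 := by
      rw [K.curv_metric, S.curv_ξ, S.g_horiz_ξ, S.g_φ_ξ]; simp
    simp only [h2, h, map_add, map_sub, map_smul, LinearMap.add_apply, LinearMap.sub_apply,
      LinearMap.smul_apply, smul_eq_mul, S.g_ξ_ξ, S.g_horiz_ξ, S.g_φ_ξ, S.φ_horiz] at h1
    refine cancel hb' (S.κ_cancel (two_cancel ?_))
    linear_combination -h1
  · have key : ∃ s : C, ∀ X, a • K.covDeriv ξ X = s • K.horiz ξ X := by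
      -- The scalar is read off from the horizontal part of R(PX, ξ)U, computed in both ways. The
      -- difference V to be killed is horizontal, so pairing that identity with V itself suffices.
      refine ⟨κ * θ ξ - θ ξ * σ + K.der ξ σ, fun X ↦ ?_⟩
      rw [← sub_eq_zero]
      set V := a • K.covDeriv ξ X - (κ * θ ξ - θ ξ * σ + K.der ξ σ) • K.horiz ξ X with hV
      have hVξ : K.g ξ V = 0 := by
        rw [K.g_symm, hV]
        simp [S.g_covDeriv_ξ, S.g_horiz_ξ]
      refine K.g_definite _ ?_
      have h1 := congrArg (fun W ↦ K.g W V) (hc (K.horiz ξ X) ξ)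
      have h2 : K.g U ξ = θ ξ := hU ξ
      simp only [S.curv_eq, h, map_add, map_sub, map_smul, LinearMap.add_apply,
        LinearMap.sub_apply, LinearMap.smul_apply, smul_eq_mul, S.g_ξ_ξ, S.g_horiz_ξ, hVξ,
        S.covDeriv_ξ, map_zero, LinearMap.zero_apply, S.horiz_horiz, S.covDeriv_horiz, h2] at h1
      have h3 : K.g V V = a * K.g (K.covDeriv ξ X) V
          - (κ * θ ξ - θ ξ * σ + K.der ξ σ) * K.g (K.horiz ξ X) V := by
        conv_lhs => enter [1]; rw [hV]
        simp
      rw [h3]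
      linear_combination -h1
    obtain ⟨s, hs⟩ := key
    -- aA = sP anticommutes with φ on the left and commutes with it on the right.
    have h1 : s • φ X = 0 := by
      refine two_smul_cancel (C := C) ?_
      have e1 := hs (φ X)
      have e2 := congrArg φ (hs X)
      rw [S.covDeriv_φ, S.horiz_φ] at e1
      rw [map_smul, map_smul, S.φ_horiz] at e2
      linear_combination (norm := module) -e1 - e2
    have h2 : K.covDeriv ξ X = 0 := by
      have e := congrArg φ h1
      rw [map_smul, S.φ_φ_eq_horiz, map_zero, smul_neg, neg_eq_zero, ← hs] at e
      exact cancel' hau e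
    have h3 := S.covDeriv_covDeriv_eq_horiz X
    rw [h2, map_zero] at h3
    refine cancel' S.isUnit_κ ?_
    linear_combination (norm := module) h3

end IsAlmostCosymplecticKappaMu
end RiemannianCalculus

/-! ### Smooth vector fields on a manifold as a Riemannian calculus -/

section Manifold

variable {E : Type*} [NormedAddCommGroup E] [NormedSpace ℝ E]
  {H : Type*} [TopologicalSpace H] {I : ModelWithCorners ℝ E H}
  {M : Type*} [TopologicalSpace M] [ChartedSpace H M]

/-- The smooth functions on `M`. -/
abbrev SmoothFun (I : ModelWithCorners ℝ E H) (M : Type*) [TopologicalSpace M]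
    [ChartedSpace H M] : Type _ := C^∞⟮I, M; 𝓘(ℝ, ℝ), ℝ⟯

lemma SmoothFun.mdiffAt (f : SmoothFun I M) (x : M) : MDiffAt f x :=
  f.contMDiff.mdifferentiableAt (by simp)

lemma contMDiff_of_trivial_section {f : M → ℝ}
    (h : ContMDiff I (I.prod 𝓘(ℝ, ℝ)) ∞
      (fun x ↦ TotalSpace.mk' ℝ (E := Bundle.Trivial M ℝ) x (f x))) :
    CMDiff ∞ f := by
  intro x
  have := h x
  rw [contMDiffAt_totalSpace] at this
  exact this.2

variable [IsManifold I ∞ M]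

/-- The module of smooth vector fields on `M`. -/
abbrev SmoothField (I : ModelWithCorners ℝ E H) (M : Type*) [TopologicalSpace M]
    [ChartedSpace H M] [IsManifold I ∞ M] : Type _ :=
  Cₛ^∞⟮I; E, (TangentSpace I : M → Type _)⟯

namespace SmoothField

instance : SMul (SmoothFun I M) (SmoothField I M) :=
  ⟨fun f X ↦ ⟨fun x ↦ f x • X x, f.contMDiff.smul_section X.contMDiff⟩⟩

@[simp] lemma smul_apply (f : SmoothFun I M) (X : SmoothField I M) (x : M) :
    (f • X) x = f x • X x := rfl

@[simp] lemma add_apply (X Y : SmoothField I M) (x : M) : (X + Y) x = X x + Y x := rfl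
@[simp] lemma sub_apply (X Y : SmoothField I M) (x : M) : (X - Y) x = X x - Y x := rfl
@[simp] lemma zero_apply (x : M) : (0 : SmoothField I M) x = 0 := rfl

instance : Module (SmoothFun I M) (SmoothField I M) where
  one_smul X := by ext x; simp
  mul_smul f g X := by ext x; simp [mul_smul]
  smul_zero f := by ext x; simp
  smul_add f X Y := by ext x; simp
  add_smul f g X := by ext x; simp [add_smul]
  zero_smul X := by ext x; simp

lemma mdiffAt (X : SmoothField I M) (x : M) : DiffVectorFieldAt I X x := X.mdifferentiableAt

end SmoothField

lemma ContMDiff.mvfderiv_apply {f : M → ℝ} (hf : CMDiff ∞ f) {X : Π x : M, TangentSpace I x}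
    (hX : SmoothVectorField I X) : CMDiff ∞ (fun x ↦ d% f x (X x)) := by
  have h := (contMDiff_snd_tangentBundle_modelSpace ℝ 𝓘(ℝ, ℝ) (n := ∞)).comp
    ((hf.contMDiff_tangentMap (m := ∞) (by simp)).comp hX)
  exact h

/-- The derivation of the algebra of smooth functions given by a smooth vector field. -/
def SmoothField.der : SmoothField I M →ₗ[SmoothFun I M]
    Derivation ℝ (SmoothFun I M) (SmoothFun I M) where
  toFun X := Derivation.mk'
    { toFun := fun f ↦ ⟨fun x ↦ d% f x (X x), f.contMDiff.mvfderiv_apply X.contMDiff⟩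
      map_add' := fun f g ↦ by
        ext x
        have := mvfderiv_add (f.mdiffAt x) (g.mdiffAt x)
        exact congrArg (fun T ↦ T (X x)) this
      map_smul' := fun c f ↦ by
        ext x
        have := mvfderiv_smul (a := fun _ ↦ c) mdifferentiableAt_const (f.mdiffAt x)
        rw [mvfderiv_const] at this
        have := congrArg (fun T ↦ T (X x)) this
        simpa using! this }
    (fun f g ↦ by
      ext x
      have := mvfderiv_mul (f.mdiffAt x) (g.mdiffAt x)
      exact congrArg (fun T ↦ T (X x)) this)
  map_add' X Y := by ext f x; exact map_add (d% f x) _ _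
  map_smul' f X := by ext g x; exact map_smul (d% g x) _ _

/-- The evaluation of a smooth 1-form on smooth vector fields. -/
def IsSmoothOneForm.toLinearMap {α : Π x : M, TangentSpace I x →L[ℝ] ℝ} (hα : IsSmoothOneForm I α) :
    SmoothField I M →ₗ[SmoothFun I M] SmoothFun I M where
  toFun X := ⟨fun x ↦ α x (X x),
    contMDiff_of_trivial_section (ContMDiff.clm_bundle_apply (b := id) hα X.contMDiff)⟩
  map_add' X Y := by ext x; exact map_add (α x) _ _
  map_smul' f X := by ext x; exact map_smul (α x) _ _

/-- The action of a smooth `(1,1)`-tensor field on smooth vector fields. -/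
def IsSmoothEndomorphismField.toLinearMap
    {φ : Π x : M, TangentSpace I x →L[ℝ] TangentSpace I x} (hφ : IsSmoothEndomorphismField I φ) :
    SmoothField I M →ₗ[SmoothFun I M] SmoothField I M where
  toFun X := ⟨fun x ↦ φ x (X x), ContMDiff.clm_bundle_apply (b := id) hφ X.contMDiff⟩
  map_add' X Y := by ext x; exact map_add (φ x) _ _
  map_smul' f X := by ext x; exact map_smul (φ x) _ _

/-- The pairing of smooth vector fields under a Riemannian metric. -/
def SmoothField.metric (g : ContMDiffRiemannianMetric I ∞ E (TangentSpace I : M → Type _)) :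
    SmoothField I M →ₗ[SmoothFun I M] SmoothField I M →ₗ[SmoothFun I M] SmoothFun I M :=
  LinearMap.mk₂ _ (fun X Y ↦ ⟨fun x ↦ g.inner x (X x) (Y x),
      contMDiff_of_trivial_section
        (ContMDiff.clm_bundle_apply₂ (b := id) g.contMDiff X.contMDiff Y.contMDiff)⟩)
    (fun X X' Y ↦ by ext x; exact congrArg (fun T ↦ T (Y x)) (map_add (g.inner x) _ _))
    (fun f X Y ↦ by ext x; exact congrArg (fun T ↦ T (Y x)) (map_smul (g.inner x) _ _))
    (fun X Y Y' ↦ by ext x; exact map_add (g.inner x (X x)) _ _)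
    (fun f X Y ↦ by ext x; exact map_smul (g.inner x (X x)) _ _)

/-- The action of a smooth connection on smooth vector fields. -/
def IsSmoothTorsionFree.cov {D : CovariantDerivative I E (TangentSpace I : M → Type _)}
    (hD : IsSmoothTorsionFree D) :
    SmoothField I M →ₗ[SmoothFun I M] SmoothField I M →+ SmoothField I M where
  toFun X :=
    { toFun := fun Y ↦ ⟨fun x ↦ D Y x (X x), ContMDiff.clm_bundle_apply (b := id)
        (contMDiffOn_univ.1 ((hD.smooth Set.univ isOpen_univ).contMDiff
          (contMDiffOn_univ.2 Y.contMDiff))) X.contMDiff⟩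
      map_zero' := by
        ext x
        exact congrArg (fun T ↦ T x (X x)) D.zero
      map_add' := fun Y Y' ↦ by
        ext x
        have := D.isCovariantDerivativeOnUniv.add (Y.mdiffAt x) (Y'.mdiffAt x)
        exact congrArg (fun T ↦ T (X x)) this }
  map_add' X Y := by ext Z x; exact map_add (D Z x) _ _
  map_smul' f X := by ext Z x; exact map_smul (D Z x) _ _

end Manifold

section Manifold

variable {E : Type*} [NormedAddCommGroup E] [NormedSpace ℝ E]
  {H : Type*} [TopologicalSpace H] {I : ModelWithCorners ℝ E H}
  {M : Type*} [TopologicalSpace M] [ChartedSpace H M] [IsManifold I ∞ M]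
  {D nab : CovariantDerivative I E (TangentSpace I : M → Type _)}
  {g : ContMDiffRiemannianMetric I ∞ E (TangentSpace I : M → Type _)}

namespace IsSmoothTorsionFree

lemma cov_leibniz (hD : IsSmoothTorsionFree D) (X : SmoothField I M) (f : SmoothFun I M)
    (Y : SmoothField I M) :
    hD.cov X (f • Y) = f • hD.cov X Y + SmoothField.der X f • Y := by
  ext x
  have := D.isCovariantDerivativeOnUniv.leibniz (Y.mdiffAt x) (f.mdiffAt x)
  exact congrArg (fun T ↦ T (X x)) this

lemma mlieBracket_eq (hD : IsSmoothTorsionFree D) (X Y : SmoothField I M) :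
    mlieBracket I X Y = ⇑(hD.cov X Y - hD.cov Y X) := by
  ext x
  exact (hD.torsion_free x X Y (X.mdiffAt x) (Y.mdiffAt x)).symm

variable [CompleteSpace E]

lemma jacobi (hD : IsSmoothTorsionFree D) (X Y Z : SmoothField I M) :
    hD.cov X (hD.cov Y Z - hD.cov Z Y) - hD.cov (hD.cov Y Z - hD.cov Z Y) X =
    hD.cov (hD.cov X Y - hD.cov Y X) Z - hD.cov Z (hD.cov X Y - hD.cov Y X) +
    (hD.cov Y (hD.cov X Z - hD.cov Z X) - hD.cov (hD.cov X Z - hD.cov Z X) Y) := by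
  have : IsManifold I (minSmoothness ℝ 3) M :=
    IsManifold.of_le (n := ∞) (by simp; exact ENat.LEInfty.out)
  have hle : minSmoothness ℝ 2 ≤ ∞ := by simp; exact ENat.LEInfty.out
  have h := leibniz_identity_mlieBracket (I := I) (X.contMDiff.of_le hle)
    (Y.contMDiff.of_le hle) (Z.contMDiff.of_le hle)
  apply DFunLike.coe_injective
  rw [← hD.mlieBracket_eq, ContMDiffSection.coe_add, ← hD.mlieBracket_eq, ← hD.mlieBracket_eq,
    ← hD.mlieBracket_eq, ← hD.mlieBracket_eq, ← hD.mlieBracket_eq]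
  exact h

end IsSmoothTorsionFree

variable [CompleteSpace E]

/-- The calculus of smooth vector fields of a Riemannian manifold with a unit vector field. -/
def IsLeviCivita.calculus (hnab : IsLeviCivita g nab) {ξ : SmoothField I M}
    (hξ : SmoothField.metric g ξ ξ = 1) :
    RiemannianCalculus (SmoothFun I M) (SmoothField I M) where
  der := SmoothField.der
  g := SmoothField.metric g
  nab := hnab.toIsSmoothTorsionFree.cov
  g_symm X Y := by ext x; exact g.symm x _ _
  g_definite X h := by
    ext x
    by_contra hx
    exact (g.pos x (X x) hx).ne' (congrArg (fun f : SmoothFun I M ↦ f x) h)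
  leibniz := hnab.toIsSmoothTorsionFree.cov_leibniz
  metric X Y Z := by
    ext x
    exact hnab.deriv_metric x (X x) Y Z (Y.mdiffAt x) (Z.mdiffAt x)
  der_bracket X Y f := by
    -- The Jacobi identity for (X, Y, fξ) minus f times that for (X, Y, ξ) leaves ([X, Y]f - X(Yf) +
    -- Y(Xf))ξ = 0. Pairing with the unit field ξ removes ξ.
    have h1 := hnab.toIsSmoothTorsionFree.jacobi X Y (f • ξ)
    have h2 := congrArg (f • ·) (hnab.toIsSmoothTorsionFree.jacobi X Y ξ)
    simp only [hnab.toIsSmoothTorsionFree.cov_leibniz, map_sub, map_add, map_smul,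
      AddMonoidHom.sub_apply, AddMonoidHom.add_apply, AddMonoidHom.smul_apply] at h1 h2
    have h3 : (SmoothField.der (hnab.toIsSmoothTorsionFree.cov X Y
        - hnab.toIsSmoothTorsionFree.cov Y X) f
        - (SmoothField.der X (SmoothField.der Y f) - SmoothField.der Y (SmoothField.der X f))) • ξ
        = 0 := by
      simp only [map_sub, Derivation.sub_apply]
      linear_combination (norm := module) h2 - h1
    have h4 := congrArg (fun V ↦ SmoothField.metric g V ξ) h3
    simp only [map_smul, LinearMap.smul_apply, hξ, map_zero, LinearMap.zero_apply, smul_eq_mul,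
      mul_one] at h4
    exact sub_eq_zero.1 h4
  bianchi X Y Z := by
    have h := hnab.toIsSmoothTorsionFree.jacobi X Y Z
    simp only [map_sub, AddMonoidHom.sub_apply] at *
    linear_combination (norm := module) h

end Manifold

/-! ### Localization: the Ricci tensor as a trace over global fields -/

section Manifold

variable {E : Type*} [NormedAddCommGroup E] [NormedSpace ℝ E] [FiniteDimensional ℝ E]
  {H : Type*} [TopologicalSpace H] {I : ModelWithCorners ℝ E H}
  {M : Type*} [TopologicalSpace M] [ChartedSpace H M] [IsManifold I ∞ M]
  {D nab : CovariantDerivative I E (TangentSpace I : M → Type _)}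
  {g : ContMDiffRiemannianMetric I ∞ E (TangentSpace I : M → Type _)}

open Filter Topology in
-- A bump function makes the local extensions in the definition of `ricci` global without changing
-- their germs at x; curvature depends only on germs.
lemma SmoothField.exists_eventuallyEq_extend [T2Space M] {x : M} (v : TangentSpace I x) :
    ∃ X : SmoothField I M, ∀ᶠ y in 𝓝 x, X y = FiberBundle.extend E v y := by
  obtain ⟨s, hs, hv⟩ := FiberBundle.exists_contMDiffOn_extend I E (k := ∞) v
  obtain ⟨f, -, hf⟩ := (SmoothBumpFunction.nhds_basis_tsupport (I := I) x).mem_iff.1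
    (interior_mem_nhds.2 hs)
  refine ⟨⟨⇑f • FiberBundle.extend E v, ContMDiffOn.smul_section_of_tsupport
    (f.contMDiff.contMDiffOn) isOpen_interior hf (hv.mono interior_subset)⟩, ?_⟩
  filter_upwards [f.eventuallyEq_one] with y hy
  change f y • FiberBundle.extend E v y = _
  rw [hy, Pi.one_apply, one_smul]

lemma SmoothField.exists_apply_eq [T2Space M] {x : M} (v : TangentSpace I x) :
    ∃ X : SmoothField I M, X x = v := by
  obtain ⟨X, hX⟩ := SmoothField.exists_eventuallyEq_extend v
  exact ⟨X, by rw [hX.self_of_nhds, FiberBundle.extend_apply_self]⟩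

omit [FiniteDimensional ℝ E] in
lemma IsSmoothTorsionFree.curvature_eq (hD : IsSmoothTorsionFree D) (X Y Z : SmoothField I M)
    (x : M) : curvature D X Y Z x =
      (hD.cov X (hD.cov Y Z) - hD.cov Y (hD.cov X Z) - hD.cov (hD.cov X Y - hD.cov Y X) Z) x := by
  unfold curvature
  rw [hD.mlieBracket_eq]
  rfl

omit [FiniteDimensional ℝ E] in
open Filter Topology in
lemma IsSmoothTorsionFree.curvature_congr (hD : IsSmoothTorsionFree D) (X Y Z : SmoothField I M)
    {X' Y' Z' : Π x : M, TangentSpace I x} {x : M} (hX : ∀ᶠ y in 𝓝 x, X y = X' y)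
    (hY : ∀ᶠ y in 𝓝 x, Y y = Y' y) (hZ : ∀ᶠ y in 𝓝 x, Z y = Z' y) :
    curvature D X' Y' Z' x = curvature D X Y Z x := by
  have hdiff {V : SmoothField I M} {V' : Π x : M, TangentSpace I x} {y : M}
      (h : ∀ᶠ z in 𝓝 y, V z = V' z) : DiffVectorFieldAt I V' y :=
    (V.mdiffAt y).congr_of_eventuallyEq (h.mono fun z hz ↦ by simp [hz])
  have hcov {V : SmoothField I M} {V' : Π x : M, TangentSpace I x} {y : M}
      (h : ∀ᶠ z in 𝓝 y, V z = V' z) : D V y = D V' y :=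
    D.isCovariantDerivativeOnUniv.congr_of_eventuallyEq (V.mdiffAt y) (hdiff h) univ_mem h
  have hZZ : ∀ᶠ y in 𝓝 x, D Z y = D Z' y := hZ.eventually_nhds.mono fun y hy ↦ hcov hy
  have h1 : D (fun y ↦ D Z y (Y y)) x = D (fun y ↦ D Z' y (Y' y)) x :=
    hcov (V := hD.cov Y Z) (by filter_upwards [hY, hZZ] with y h1 h2; rw [← h1, ← h2]; rfl)
  have h2 : D (fun y ↦ D Z y (X y)) x = D (fun y ↦ D Z' y (X' y)) x :=
    hcov (V := hD.cov X Z) (by filter_upwards [hX, hZZ] with y h1 h2; rw [← h1, ← h2]; rfl)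
  have h3 : mlieBracket I X Y x = mlieBracket I X' Y' x :=
    Filter.EventuallyEq.mlieBracket_vectorField_eq hX hY
  unfold curvature
  rw [← h1, ← h2, ← h3, ← hcov hZ, hX.self_of_nhds, hY.self_of_nhds]

lemma IsSmoothTorsionFree.ricci_eq_trace [T2Space M] (hD : IsSmoothTorsionFree D) {x : M}
    (v w : TangentSpace I x) (L : TangentSpace I x →ₗ[ℝ] TangentSpace I x)
    (hL : ∀ X Y Z : SmoothField I M, Y x = v → Z x = w →
      (hD.cov X (hD.cov Y Z) - hD.cov Y (hD.cov X Z) - hD.cov (hD.cov X Y - hD.cov Y X) Z) x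
        = L (X x)) :
    ricci D x v w = LinearMap.trace ℝ (TangentSpace I x) L := by
  let b : Module.Basis (Fin (Module.finrank ℝ E)) ℝ (TangentSpace I x) := Module.finBasis ℝ E
  rw [LinearMap.trace_eq_matrix_trace ℝ b]
  refine Finset.sum_congr rfl fun i _ ↦ ?_
  rw [Matrix.diag_apply, LinearMap.toMatrix_apply]
  obtain ⟨X, hX⟩ := SmoothField.exists_eventuallyEq_extend (b i)
  obtain ⟨Y, hY⟩ := SmoothField.exists_eventuallyEq_extend v
  obtain ⟨Z, hZ⟩ := SmoothField.exists_eventuallyEq_extend w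
  have e {V : SmoothField I M} {v : TangentSpace I x}
      (h : ∀ᶠ y in nhds x, V y = FiberBundle.extend E v y) : V x = v := by
    rw [h.self_of_nhds, FiberBundle.extend_apply_self]
  rw [← e hX, ← hL X Y Z (e hY) (e hZ), ← hD.curvature_eq, e hX,
    ← hD.curvature_congr X Y Z hX hY hZ]

end Manifold

/-! ### The given structure as an instance of the algebraic one -/

namespace AlmostContactMetricStructure

variable {n : ℕ} {M : Type*} [TopologicalSpace M]
  [ChartedSpace (EuclideanSpace ℝ (Fin (2 * n + 1))) M] [IsManifold (𝓡 (2 * n + 1)) ∞ M]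
  (S : AlmostContactMetricStructure n M)
  {nab : CovariantDerivative (𝓡 (2 * n + 1)) (EuclideanSpace ℝ (Fin (2 * n + 1)))
      (TangentSpace (𝓡 (2 * n + 1)) : M → Type _)}

/-- The Reeb field as an element of the module of smooth vector fields. -/
def reeb : SmoothField (𝓡 (2 * n + 1)) M := ⟨S.ξ, S.smooth_ξ⟩

lemma metric_reeb (X : SmoothField (𝓡 (2 * n + 1)) M) :
    SmoothField.metric S.g X S.reeb = S.smooth_η.toLinearMap X := by
  ext x; exact S.g_ξ x (X x)

lemma metric_reeb_reeb : SmoothField.metric S.g S.reeb S.reeb = 1 := by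
  ext x; exact (S.g_ξ x _).trans (S.η_ξ x)

variable {S}

lemma two_h (S : AlmostContactMetricStructure n M)
    (hnab : IsLeviCivita S.g nab) (X : SmoothField (𝓡 (2 * n + 1)) M) (x : M) :
    (2 : ℝ) • S.h X x =
      (hnab.cov S.reeb (S.smooth_φ.toLinearMap X) - hnab.cov (S.smooth_φ.toLinearMap X) S.reeb
        - S.smooth_φ.toLinearMap (hnab.cov S.reeb X - hnab.cov X S.reeb)) x := by
  have e1 := congrFun (hnab.mlieBracket_eq S.reeb (S.smooth_φ.toLinearMap X)) x
  have e2 := congrFun (hnab.mlieBracket_eq S.reeb X) x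
  rw [SmoothField.sub_apply, ← e1]
  change _ = _ - S.φ x ((hnab.cov S.reeb X - hnab.cov X S.reeb) x)
  rw [← e2]
  unfold AlmostContactMetricStructure.h
  rw [smul_smul]
  norm_num
  rfl

lemma two_curv_reeb (hnab : IsLeviCivita S.g nab) {κ μ : ℝ} (hκμ : S.IsKappaMu nab κ μ)
    (X Y : SmoothField (𝓡 (2 * n + 1)) M) :
    (2 : SmoothFun (𝓡 (2 * n + 1)) M) • (hnab.calculus S.metric_reeb_reeb).curv X Y S.reeb =
      (2 * algebraMap ℝ (SmoothFun (𝓡 (2 * n + 1)) M) κ) •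
        (SmoothField.metric S.g Y S.reeb • X - SmoothField.metric S.g X S.reeb • Y)
      + algebraMap ℝ (SmoothFun (𝓡 (2 * n + 1)) M) μ •
        (SmoothField.metric S.g Y S.reeb • (hnab.cov S.reeb (S.smooth_φ.toLinearMap X)
            - hnab.cov (S.smooth_φ.toLinearMap X) S.reeb
            - S.smooth_φ.toLinearMap (hnab.cov S.reeb X - hnab.cov X S.reeb))
          - SmoothField.metric S.g X S.reeb • (hnab.cov S.reeb (S.smooth_φ.toLinearMap Y)
            - hnab.cov (S.smooth_φ.toLinearMap Y) S.reeb
            - S.smooth_φ.toLinearMap (hnab.cov S.reeb Y - hnab.cov Y S.reeb))) := by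
  rw [S.metric_reeb, S.metric_reeb]
  ext x
  have hc : (hnab.calculus S.metric_reeb_reeb).curv X Y S.reeb x = curvature nab X Y S.reeb x :=
    (hnab.curvature_eq X Y S.reeb x).symm
  have hk : curvature nab X Y S.reeb x = κ • (S.η x (Y x) • X x - S.η x (X x) • Y x)
      + μ • (S.η x (Y x) • S.h X x - S.η x (X x) • S.h Y x) :=
    hκμ x X Y (X.contMDiff x) (Y.contMDiff x)
  have hX := S.two_h hnab X x
  have hY := S.two_h hnab Y x
  generalize (hnab.calculus S.metric_reeb_reeb).curv X Y S.reeb = R at *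
  generalize hnab.cov S.reeb (S.smooth_φ.toLinearMap X) - hnab.cov (S.smooth_φ.toLinearMap X) S.reeb
    - S.smooth_φ.toLinearMap (hnab.cov S.reeb X - hnab.cov X S.reeb) = P at *
  generalize hnab.cov S.reeb (S.smooth_φ.toLinearMap Y) - hnab.cov (S.smooth_φ.toLinearMap Y) S.reeb
    - S.smooth_φ.toLinearMap (hnab.cov S.reeb Y - hnab.cov Y S.reeb) = Q at *
  rw [← map_ofNat (algebraMap ℝ (SmoothFun (𝓡 (2 * n + 1)) M)) 2]
  change (2 : ℝ) • R x = (2 * κ) • (S.η x (Y x) • X x - S.η x (X x) • Y x)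
    + μ • (S.η x (Y x) • P x - S.η x (X x) • Q x)
  rw [hc, hk, ← hX, ← hY]
  module

lemma isAlmostCosymplecticKappaMu (hS : S.IsAlmostCosymplectic) (hnab : IsLeviCivita S.g nab)
    {κ μ : ℝ} (hκ : κ ≠ 0) (hκμ : S.IsKappaMu nab κ μ) :
    (hnab.calculus S.metric_reeb_reeb).IsAlmostCosymplecticKappaMu S.smooth_φ.toLinearMap S.reeb
      (algebraMap ℝ _ κ) (algebraMap ℝ _ μ) where
  g_ξ_ξ := S.metric_reeb_reeb
  φ_φ X := by
    change _ = -X + SmoothField.metric S.g X S.reeb • S.reeb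
    rw [S.metric_reeb]
    ext x; exact S.φ_φ x (X x)
  g_φ_ξ X := by
    change SmoothField.metric S.g _ S.reeb = 0
    rw [S.metric_reeb]
    ext x; exact S.η_φ x (X x)
  φ_ξ := by ext x; exact S.φ_ξ x
  g_φ_φ X Y := by
    change _ = SmoothField.metric S.g X Y
      - SmoothField.metric S.g X S.reeb * SmoothField.metric S.g Y S.reeb
    rw [S.metric_reeb, S.metric_reeb]
    ext x; exact S.g_φ_φ x (X x) (Y x)
  closed_η X Y := by
    change SmoothField.der X (SmoothField.metric S.g Y S.reeb)
      - SmoothField.der Y (SmoothField.metric S.g X S.reeb)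
      - SmoothField.metric S.g _ S.reeb = 0
    rw [S.metric_reeb, S.metric_reeb, S.metric_reeb]
    ext x
    have h := hS.1 x X Y (X.mdiffAt x) (Y.mdiffAt x)
    unfold extDerivOneForm at h
    rw [hnab.mlieBracket_eq] at h
    exact h
  closed_ω X Y Z := by
    ext x
    have h := hS.2 x X Y Z (X.mdiffAt x) (Y.mdiffAt x) (Z.mdiffAt x)
    unfold extDerivTwoForm at h
    rw [hnab.mlieBracket_eq, hnab.mlieBracket_eq, hnab.mlieBracket_eq] at h
    exact h
  isUnit_κ := (isUnit_iff_ne_zero.2 hκ).map (algebraMap ℝ _)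
  der_κ X := Derivation.map_algebraMap _ _
  der_μ X := Derivation.map_algebraMap _ _
  two_curv_ξ := two_curv_reeb hnab hκμ

end AlmostContactMetricStructure

/-! ### The Ricci tensor of a closed Weyl connection -/

section Manifold

variable {E : Type*} [NormedAddCommGroup E] [NormedSpace ℝ E] [FiniteDimensional ℝ E]
  {H : Type*} [TopologicalSpace H] {I : ModelWithCorners ℝ E H}
  {M : Type*} [TopologicalSpace M] [ChartedSpace H M] [IsManifold I ∞ M]
  {D nab : CovariantDerivative I E (TangentSpace I : M → Type _)}
  {g : ContMDiffRiemannianMetric I ∞ E (TangentSpace I : M → Type _)}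
  {θ : Π x : M, TangentSpace I x →L[ℝ] ℝ}

lemma IsWeylConnection.isClosedWeyl (hD : IsWeylConnection g θ D) (hθ : IsClosedOneForm θ)
    (hnab : IsLeviCivita g nab) {ξ : SmoothField I M} (hξ : SmoothField.metric g ξ ξ = 1) :
    (hnab.calculus hξ).IsClosedWeyl hD.cov hD.smooth_lee.toLinearMap where
  leibniz := hD.cov_leibniz
  torsion_free X Y := by
    apply DFunLike.coe_injective
    rw [← hD.mlieBracket_eq]
    exact hnab.mlieBracket_eq X Y
  metric X Y Z := by
    rw [← map_ofNat (algebraMap ℝ (SmoothFun I M)) 2]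
    ext x
    exact hD.deriv_metric x (X x) Y Z (Y.mdiffAt x) (Z.mdiffAt x)
  closed X Y := by
    ext x
    have h := hθ x X Y (X.mdiffAt x) (Y.mdiffAt x)
    unfold extDerivOneForm at h
    rw [hnab.mlieBracket_eq] at h
    exact h

/-- The Ricci tensor of a closed Weyl connection. -/
lemma IsWeylConnection.exists_ricci_eq [T2Space M] (hD : IsWeylConnection g θ D)
    (hθ : IsClosedOneForm θ)
    (hnab : IsLeviCivita g nab) {ξ : SmoothField I M} (hξ : SmoothField.metric g ξ ξ = 1)
    {U : SmoothField I M} (hU : ∀ Z, SmoothField.metric g U Z = hD.smooth_lee.toLinearMap Z)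
    (x : M) (R : TangentSpace I x → TangentSpace I x → TangentSpace I x →ₗ[ℝ] TangentSpace I x)
    (hR : ∀ X Y Z : SmoothField I M,
      (hnab.calculus hξ).curv X Y Z x = R (Y x) (Z x) (X x)) :
    ∃ s : ℝ, ∀ v w : TangentSpace I x, ricci D x v w = LinearMap.trace ℝ _ (R v w)
      - ((Module.finrank ℝ E : ℝ) - 2) * (g.inner x (nab U x v) w - θ x v * θ x w)
      - s * g.inner x v w := by
  have hW := hD.isClosedWeyl hθ hnab hξ
  let N : TangentSpace I x →ₗ[ℝ] TangentSpace I x := (nab U x).toLinearMap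
  -- The coefficient of g in the trace of the curvature formula: N = ∇U contributes the divergence
  -- of U, and m = dim M contributes (m - 1)θ(U).
  refine ⟨LinearMap.trace ℝ _ N - θ x (U x) + ((Module.finrank ℝ E : ℝ) - 1) * θ x (U x),
    fun v w ↦ ?_⟩
  let q (v : TangentSpace I x) : TangentSpace I x →ₗ[ℝ] ℝ := (g.inner x v).toLinearMap
  let t : TangentSpace I x →ₗ[ℝ] ℝ := (θ x).toLinearMap
  have hq (v w : TangentSpace I x) : g.inner x v w = g.inner x w v := g.symm x v w
  let L : TangentSpace I x →ₗ[ℝ] TangentSpace I x :=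
    R v w + ((q w ∘ₗ N) - t w • t).smulRight v - (q w (N v) - t v * t w) • LinearMap.id
      - q v w • (N - t.smulRight (U x)) + (q w).smulRight (N v - t v • U x)
      - t (U x) • (q v w • LinearMap.id - (q w).smulRight v)
  have hL : ricci D x v w = LinearMap.trace ℝ _ L := by
    refine hD.ricci_eq_trace v w L fun X Y Z hY hZ ↦ ?_
    have h := congrArg (fun V : SmoothField I M ↦ V x) (hW.curv_eq hU X Y Z)
    have ht : hD.cov X Y - hD.cov Y X = (hnab.calculus hξ).nab X Y - (hnab.calculus hξ).nab Y X :=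
      hW.torsion_free X Y
    rw [ht]
    refine h.trans ?_
    have hRx := hR X Y Z
    rw [hY, hZ] at hRx
    change (hnab.calculus hξ).curv X Y Z x + (g.inner x (nab U x (X x)) (Z x)
      - θ x (X x) * θ x (Z x)) • Y x - (g.inner x (nab U x (Y x)) (Z x)
      - θ x (Y x) * θ x (Z x)) • X x - g.inner x (Y x) (Z x) • (nab U x (X x) - θ x (X x) • U x)
      + g.inner x (X x) (Z x) • (nab U x (Y x) - θ x (Y x) • U x)
      - θ x (U x) • (g.inner x (Y x) (Z x) • X x - g.inner x (X x) (Z x) • Y x) =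
      R v w (X x) + (g.inner x w (nab U x (X x)) - θ x w * θ x (X x)) • v
      - (g.inner x w (nab U x v) - θ x v * θ x w) • X x
      - g.inner x v w • (nab U x (X x) - θ x (X x) • U x)
      + g.inner x w (X x) • (nab U x v - θ x v • U x)
      - θ x (U x) • (g.inner x v w • X x - g.inner x w (X x) • v)
    rw [hRx, hY, hZ, hq w, hq w, hq w]
    module
  rw [hL]
  have : FiniteDimensional ℝ (TangentSpace I x) := inferInstanceAs (FiniteDimensional ℝ E)
  have hfin : Module.finrank ℝ (TangentSpace I x) = Module.finrank ℝ E := rfl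
  simp only [L, map_add, map_sub, map_smul, LinearMap.trace_smulRight, LinearMap.trace_id,
    LinearMap.sub_apply, LinearMap.smul_apply, LinearMap.comp_apply, smul_eq_mul, hfin]
  have h1 : q w (N v) = g.inner x (nab U x v) w := hq _ _
  have h2 : q w (U x) = t w := by
    obtain ⟨Z, rfl⟩ := SmoothField.exists_apply_eq w
    exact (hq _ _).trans (congrArg (fun f : SmoothFun I M ↦ f x) (hU Z))
  have h3 : q w v = q v w := hq _ _
  change LinearMap.trace ℝ _ (R v w) + (q w (N v) - t w * t v) - _ - _ + _ - _ =
    _ - _ * (g.inner x (nab U x v) w - t v * t w) - (_ - t (U x) + _ * t (U x)) * q v w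
  rw [← h1]
  simp only [h2, h3]
  ring

end Manifold

/-! ### Traces on a tangent space -/

section

variable {V : Type*} [AddCommGroup V] [Module ℝ V]
  {f a : V →ₗ[ℝ] V} {e : V →ₗ[ℝ] ℝ} {ξ : V}

/-- The image of a lies in ker e, where f² = -1, so a = -f²a = faf. By cyclicity faf and f²a have
the same trace, so tr a = -tr a. -/
lemma trace_eq_zero_of_anticommute (hf : ∀ v, f (f v) = -v + e v • ξ) (he : ∀ v, e (a v) = 0)
    (hfa : ∀ v, a (f v) = -f (a v)) : LinearMap.trace ℝ V a = 0 := by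
  have h1 : a = -(f * (f * a)) := by ext v; simp [hf, he]
  have h2 : f * a * f = -(f * (f * a)) := by ext v; simp [hfa]
  have h3 := congrArg (LinearMap.trace ℝ V) h2
  rw [LinearMap.trace_mul_comm, ← h1] at h3
  have h4 := congrArg (LinearMap.trace ℝ V) h1
  rw [map_neg] at h4
  linarith

lemma trace_comp_eq_zero_of_anticommute (hfa : ∀ v, a (f v) = -f (a v)) :
    LinearMap.trace ℝ V (f ∘ₗ a) = 0 := by
  have h2 : a * f = -(f * a) := by ext v; simp [hfa]
  have h3 := congrArg (LinearMap.trace ℝ V) h2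
  rw [LinearMap.trace_mul_comm, map_neg] at h3
  change LinearMap.trace ℝ V (f * a) = 0
  linarith

/-- The endomorphism `u ↦ R(u, v)w` for the curvature of an almost cosymplectic
`(κ, μ)`-structure, with `q = g(w, ·)` and `a = ∇ξ`. -/
def kappaMuCurvature (f a : V →ₗ[ℝ] V) (e : V →ₗ[ℝ] ℝ) (ξ : V) (κ μ : ℝ) (v w : V)
    (q : V →ₗ[ℝ] ℝ) : V →ₗ[ℝ] V :=
  (q ∘ₗ a).smulRight (a v) - q (a v) • a
    + e w • (e v • (κ • (LinearMap.id - e.smulRight ξ) + μ • (f ∘ₗ a))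
      - e.smulRight (κ • (v - e v • ξ) + μ • f (a v)))
    - ((e v • (q ∘ₗ (κ • (LinearMap.id - e.smulRight ξ) + μ • (f ∘ₗ a)))).smulRight ξ
      - q (κ • (v - e v • ξ) + μ • f (a v)) • e.smulRight ξ)

lemma kappaMuCurvature_apply (f a : V →ₗ[ℝ] V) (e : V →ₗ[ℝ] ℝ) (ξ : V) (κ μ : ℝ) (v w : V)
    (q : V →ₗ[ℝ] ℝ) (u : V) : kappaMuCurvature f a e ξ κ μ v w q u =
      q (a u) • a v - q (a v) • a u
      + e w • (e v • (κ • (u - e u • ξ) + μ • f (a u)) - e u • (κ • (v - e v • ξ) + μ • f (a v)))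
      - (e v * (κ * q (u - e u • ξ) + μ * q (f (a u)))
        - e u * (κ * q (v - e v • ξ) + μ * q (f (a v)))) • ξ := by
  simp only [kappaMuCurvature, LinearMap.sub_apply, LinearMap.add_apply, LinearMap.smul_apply,
    LinearMap.smulRight_apply, LinearMap.comp_apply, LinearMap.id_apply, map_add, map_smul,
    smul_eq_mul]
  module

lemma trace_kappaMuCurvature [FiniteDimensional ℝ V] {κ μ : ℝ} (hf : ∀ v, f (f v) = -v + e v • ξ)
    (he : ∀ v, e (a v) = 0) (hef : ∀ v, e (f v) = 0) (hfa : ∀ v, a (f v) = -f (a v))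
    (heξ : e ξ = 1) (haξ : a ξ = 0) (haa : ∀ v, a (a v) = -κ • (v - e v • ξ)) (v w : V)
    (q : V →ₗ[ℝ] ℝ) : LinearMap.trace ℝ V (kappaMuCurvature f a e ξ κ μ v w q) =
      (Module.finrank ℝ V - 1) * κ * e v * e w + μ * q (f (a v)) := by
  simp only [kappaMuCurvature, map_add, map_sub, map_smul, LinearMap.trace_smulRight,
    LinearMap.trace_id, trace_eq_zero_of_anticommute hf he hfa,
    trace_comp_eq_zero_of_anticommute hfa, LinearMap.comp_apply, LinearMap.smul_apply,
    LinearMap.add_apply, LinearMap.sub_apply, LinearMap.smulRight_apply, LinearMap.id_apply, heξ,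
    haξ, haa, hef, map_zero, smul_eq_mul]
  ring

end

/-! ### The Ricci tensor and the Lee field of M -/

namespace AlmostContactMetricStructure

variable {n : ℕ} {M : Type*} [TopologicalSpace M] [T2Space M]
  [ChartedSpace (EuclideanSpace ℝ (Fin (2 * n + 1))) M] [IsManifold (𝓡 (2 * n + 1)) ∞ M]
  {S : AlmostContactMetricStructure n M}
  {nab : CovariantDerivative (𝓡 (2 * n + 1)) (EuclideanSpace ℝ (Fin (2 * n + 1)))
      (TangentSpace (𝓡 (2 * n + 1)) : M → Type _)} {κ μ : ℝ}

omit [T2Space M] in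
-- Evaluation at a point for arbitrary fields in place of A and φA, so that the concluding `rfl`
-- need not unfold them.
lemma apply_of_eq {g : ContMDiffRiemannianMetric (𝓡 (2 * n + 1)) ∞
      (EuclideanSpace ℝ (Fin (2 * n + 1))) (TangentSpace (𝓡 (2 * n + 1)) : M → Type _)}
    {R X Y Z T P Q P' Q' : SmoothField (𝓡 (2 * n + 1)) M} (x : M)
    {p q p' q' t : TangentSpace (𝓡 (2 * n + 1)) x} (hP : P x = p) (hQ : Q x = q) (hP' : P' x = p')
    (hQ' : Q' x = q') (hT : T x = t)
    (h : R = SmoothField.metric g P Z • Q - SmoothField.metric g Q Z • P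
      + SmoothField.metric g Z T • (SmoothField.metric g Y T •
          (algebraMap ℝ (SmoothFun (𝓡 (2 * n + 1)) M) κ • (X - SmoothField.metric g X T • T)
            + algebraMap ℝ (SmoothFun (𝓡 (2 * n + 1)) M) μ • P')
        - SmoothField.metric g X T •
          (algebraMap ℝ (SmoothFun (𝓡 (2 * n + 1)) M) κ • (Y - SmoothField.metric g Y T • T)
            + algebraMap ℝ (SmoothFun (𝓡 (2 * n + 1)) M) μ • Q'))
      - (SmoothField.metric g Y T * (algebraMap ℝ (SmoothFun (𝓡 (2 * n + 1)) M) κ *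
            SmoothField.metric g (X - SmoothField.metric g X T • T) Z
            + algebraMap ℝ (SmoothFun (𝓡 (2 * n + 1)) M) μ * SmoothField.metric g P' Z)
        - SmoothField.metric g X T * (algebraMap ℝ (SmoothFun (𝓡 (2 * n + 1)) M) κ *
            SmoothField.metric g (Y - SmoothField.metric g Y T • T) Z
            + algebraMap ℝ (SmoothFun (𝓡 (2 * n + 1)) M) μ * SmoothField.metric g Q' Z)) • T) :
    R x = g.inner x p (Z x) • q - g.inner x q (Z x) • p
      + g.inner x (Z x) t • (g.inner x (Y x) t •
          (κ • (X x - g.inner x (X x) t • t) + μ • p')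
        - g.inner x (X x) t •
          (κ • (Y x - g.inner x (Y x) t • t) + μ • q'))
      - (g.inner x (Y x) t * (κ * g.inner x (X x - g.inner x (X x) t • t) (Z x)
          + μ * g.inner x p' (Z x))
        - g.inner x (X x) t * (κ * g.inner x (Y x - g.inner x (Y x) t • t) (Z x)
          + μ * g.inner x q' (Z x))) • t := by
  subst hP hQ hP' hQ' hT
  rw [h]
  rfl

omit [T2Space M] in
set_option maxHeartbeats 400000 in
lemma curv_apply_eq_kappaMuCurvature (hS : S.IsAlmostCosymplectic) (hnab : IsLeviCivita S.g nab)
    (hκ : κ ≠ 0) (hκμ : S.IsKappaMu nab κ μ) (X Y Z : SmoothField (𝓡 (2 * n + 1)) M) (x : M) :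
    (hnab.calculus S.metric_reeb_reeb).curv X Y Z x =
      kappaMuCurvature (S.φ x).toLinearMap (nab S.ξ x).toLinearMap (S.η x).toLinearMap (S.ξ x) κ μ
        (Y x) (Z x) (S.g.inner x (Z x)).toLinearMap (X x) := by
  have hK := isAlmostCosymplecticKappaMu hS hnab hκ hκμ
  have hg (v w : TangentSpace (𝓡 (2 * n + 1)) x) : S.g.inner x v w = S.g.inner x w v :=
    S.g.symm x v w
  have key (u v w : TangentSpace (𝓡 (2 * n + 1)) x) :
      S.g.inner x (nab S.ξ x u) w • nab S.ξ x v - S.g.inner x (nab S.ξ x v) w • nab S.ξ x u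
      + S.g.inner x w (S.ξ x) • (S.g.inner x v (S.ξ x) •
          (κ • (u - S.g.inner x u (S.ξ x) • (S.ξ x)) + μ • (S.φ x (nab S.ξ x u)))
        - S.g.inner x u (S.ξ x) •
          (κ • (v - S.g.inner x v (S.ξ x) • (S.ξ x)) + μ • (S.φ x (nab S.ξ x v))))
      - (S.g.inner x v (S.ξ x) * (κ * S.g.inner x (u - S.g.inner x u (S.ξ x) • (S.ξ x)) w
          + μ * S.g.inner x (S.φ x (nab S.ξ x u)) w)
        - S.g.inner x u (S.ξ x) * (κ * S.g.inner x (v - S.g.inner x v (S.ξ x) • (S.ξ x)) w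
          + μ * S.g.inner x (S.φ x (nab S.ξ x v)) w)) • (S.ξ x) =
      kappaMuCurvature (S.φ x).toLinearMap (nab S.ξ x).toLinearMap (S.η x).toLinearMap (S.ξ x) κ μ
        v w (S.g.inner x w).toLinearMap u := by
    rw [hg _ w, hg _ w, hg _ w, hg _ w, hg _ w, hg _ w, S.g_ξ, S.g_ξ, S.g_ξ]
    exact (kappaMuCurvature_apply ..).symm
  have h := hK.curv_eq X Y Z
  rw [RiemannianCalculus.horiz_apply, RiemannianCalculus.horiz_apply] at h
  refine (apply_of_eq (g := S.g) x (p := nab S.ξ x (X x)) (q := nab S.ξ x (Y x))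
    (p' := S.φ x (nab S.ξ x (X x))) (q' := S.φ x (nab S.ξ x (Y x))) (t := S.ξ x)
    rfl rfl rfl rfl rfl h).trans (key _ _ _)

lemma trace_kappaMuCurvature_apply (hS : S.IsAlmostCosymplectic) (hnab : IsLeviCivita S.g nab)
    (hκ : κ ≠ 0) (hκμ : S.IsKappaMu nab κ μ) {x : M}
    (v w : TangentSpace (𝓡 (2 * n + 1)) x) :
    LinearMap.trace ℝ (TangentSpace (𝓡 (2 * n + 1)) x) (kappaMuCurvature (S.φ x).toLinearMap
      (nab S.ξ x).toLinearMap (S.η x).toLinearMap (S.ξ x) κ μ v w (S.g.inner x w).toLinearMap) =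
      2 * n * κ * S.η x v * S.η x w + μ * S.g.inner x w (S.φ x (nab S.ξ x v)) := by
  have hK := isAlmostCosymplecticKappaMu hS hnab hκ hκμ
  have : FiniteDimensional ℝ (TangentSpace (𝓡 (2 * n + 1)) x) :=
    inferInstanceAs (FiniteDimensional ℝ (EuclideanSpace ℝ (Fin (2 * n + 1))))
  have hfin : Module.finrank ℝ (TangentSpace (𝓡 (2 * n + 1)) x) = 2 * n + 1 :=
    finrank_euclideanSpace_fin
  have at_x {X Y : SmoothField (𝓡 (2 * n + 1)) M} (h : X = Y) : X x = Y x := by rw [h]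
  have he (v : TangentSpace (𝓡 (2 * n + 1)) x) : S.η x (nab S.ξ x v) = 0 := by
    obtain ⟨X, rfl⟩ := SmoothField.exists_apply_eq v
    rw [← S.g_ξ]
    exact congrArg (fun f : SmoothFun _ M ↦ f x) (hK.g_covDeriv_ξ X)
  have hfa (v : TangentSpace (𝓡 (2 * n + 1)) x) :
      nab S.ξ x (S.φ x v) = -S.φ x (nab S.ξ x v) := by
    obtain ⟨X, rfl⟩ := SmoothField.exists_apply_eq v
    exact at_x (hK.covDeriv_φ X)
  have haa (v : TangentSpace (𝓡 (2 * n + 1)) x) :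
      nab S.ξ x (nab S.ξ x v) = -κ • (v - S.η x v • S.ξ x) := by
    obtain ⟨X, rfl⟩ := SmoothField.exists_apply_eq v
    rw [← S.g_ξ]
    exact at_x (hK.covDeriv_covDeriv X)
  refine (trace_kappaMuCurvature (S.φ_φ x) he (S.η_φ x) hfa (S.η_ξ x)
    (at_x hK.covDeriv_ξ) haa v w _).trans ?_
  rw [hfin]
  push_cast
  change (2 * n + 1 - 1) * κ * S.η x v * S.η x w + μ * S.g.inner x w (S.φ x (nab S.ξ x v)) = _
  ring

end AlmostContactMetricStructure

namespace AlmostContactMetricStructure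

variable {n : ℕ} {M : Type*} [TopologicalSpace M] [T2Space M]
  [ChartedSpace (EuclideanSpace ℝ (Fin (2 * n + 1))) M] [IsManifold (𝓡 (2 * n + 1)) ∞ M]
  {S : AlmostContactMetricStructure n M}
  {nab D : CovariantDerivative (𝓡 (2 * n + 1)) (EuclideanSpace ℝ (Fin (2 * n + 1)))
      (TangentSpace (𝓡 (2 * n + 1)) : M → Type _)}
  {θ : Π x : M, TangentSpace (𝓡 (2 * n + 1)) x →L[ℝ] ℝ} {κ μ : ℝ}

/-- The covariant derivative of the Lee field of a closed Einstein–Weyl structure at a point. -/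
lemma exists_inner_nab_eq (hS : S.IsAlmostCosymplectic) (hnab : IsLeviCivita S.g nab)
    (hκ : κ ≠ 0) (hκμ : S.IsKappaMu nab κ μ) (hD : IsWeylConnection S.g θ D)
    (hθ : IsClosedOneForm θ) (hEW : IsEinsteinWeyl S.g D) {U : SmoothField (𝓡 (2 * n + 1)) M}
    (hU : ∀ Z, SmoothField.metric S.g U Z = hD.smooth_lee.toLinearMap Z) (x : M) :
    ∃ τ : ℝ, ∀ v w : TangentSpace (𝓡 (2 * n + 1)) x, S.g.inner x (nab U x v) w =
      θ x v * θ x w + (2 * n - 1 : ℝ)⁻¹ * (2 * n * κ * S.η x v * S.η x w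
        + μ * S.g.inner x w (S.φ x (nab S.ξ x v))) + τ * S.g.inner x v w := by
  have hK := isAlmostCosymplecticKappaMu hS hnab hκ hκμ
  have hWeyl := hD.isClosedWeyl hθ hnab S.metric_reeb_reeb
  obtain ⟨Λ, -, hΛ⟩ := hEW
  have hg (v w : TangentSpace (𝓡 (2 * n + 1)) x) : S.g.inner x v w = S.g.inner x w v :=
    S.g.symm x v w
  obtain ⟨s, hs⟩ := hD.exists_ricci_eq hθ hnab S.metric_reeb_reeb hU x
    (fun v w ↦ kappaMuCurvature (S.φ x).toLinearMap (nab S.ξ x).toLinearMap (S.η x).toLinearMap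
      (S.ξ x) κ μ v w (S.g.inner x w).toLinearMap)
    fun X Y Z ↦ curv_apply_eq_kappaMuCurvature hS hnab hκ hκμ X Y Z x
  -- This factor is dim M - 2; the dimension is odd, so n = 0 needs no exception.
  have hn : (2 * n - 1 : ℝ) ≠ 0 := by
    intro h
    have h' : (2 * n : ℤ) = 1 := by exact_mod_cast sub_eq_zero.1 h
    omega
  refine ⟨-((2 * n - 1 : ℝ)⁻¹ * (s + Λ x / 2)), fun v w ↦ ?_⟩
  have h := hΛ x v w
  have hsymmH : S.g.inner x (nab U x w) v = S.g.inner x (nab U x v) w := by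
    obtain ⟨X, rfl⟩ := SmoothField.exists_apply_eq v
    obtain ⟨Y, rfl⟩ := SmoothField.exists_apply_eq w
    exact congrArg (fun f : SmoothFun _ M ↦ f x) (hWeyl.g_nab_dual hU Y X)
  have hsymmR : S.g.inner x v (S.φ x (nab S.ξ x w)) = S.g.inner x w (S.φ x (nab S.ξ x v)) := by
    rw [hg w]
    obtain ⟨X, rfl⟩ := SmoothField.exists_apply_eq v
    obtain ⟨Y, rfl⟩ := SmoothField.exists_apply_eq w
    exact congrArg (fun f : SmoothFun _ M ↦ f x) (hK.g_φ_covDeriv_symm X Y).symm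
  have hfin : (Module.finrank ℝ (EuclideanSpace ℝ (Fin (2 * n + 1))) : ℝ) - 2 = 2 * n - 1 := by
    rw [finrank_euclideanSpace_fin]; push_cast; ring
  rw [hs, hs, trace_kappaMuCurvature_apply hS hnab hκ hκμ,
    trace_kappaMuCurvature_apply hS hnab hκ hκμ, hsymmH, hsymmR, hg w v, hfin] at h
  have hc := inv_mul_cancel₀ hn
  generalize (2 * n - 1 : ℝ) = m at *
  generalize S.g.inner x (nab U x v) w = H at *
  generalize S.g.inner x w (S.φ x (nab S.ξ x v)) = p at *
  linear_combination (-H + θ x v * θ x w) * hc - m⁻¹ / 2 * h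

lemma nab_dual_eq (hS : S.IsAlmostCosymplectic) (hnab : IsLeviCivita S.g nab)
    (hκ : κ ≠ 0) (hκμ : S.IsKappaMu nab κ μ) (hD : IsWeylConnection S.g θ D)
    (hθ : IsClosedOneForm θ) (hEW : IsEinsteinWeyl S.g D) {U : SmoothField (𝓡 (2 * n + 1)) M}
    (hU : ∀ Z, SmoothField.metric S.g U Z = hD.smooth_lee.toLinearMap Z) :
    ∃ σ : SmoothFun (𝓡 (2 * n + 1)) M, ∀ X : SmoothField (𝓡 (2 * n + 1)) M,
      hnab.cov X U = hD.smooth_lee.toLinearMap X • U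
        + (algebraMap ℝ (SmoothFun (𝓡 (2 * n + 1)) M) ((2 * n - 1 : ℝ)⁻¹ * (2 * n * κ))
          * SmoothField.metric S.g X S.reeb) • S.reeb
        + algebraMap ℝ (SmoothFun (𝓡 (2 * n + 1)) M) ((2 * n - 1 : ℝ)⁻¹ * μ)
          • S.smooth_φ.toLinearMap (hnab.cov X S.reeb) + σ • X := by
  have hK := isAlmostCosymplecticKappaMu hS hnab hκ hκμ
  -- The pointwise equation only gives a number τ at each x. Evaluating it at (ξ, ξ) identifies τ
  -- with this smooth function.
  refine ⟨SmoothField.metric S.g (hnab.cov S.reeb U) S.reeb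
    - hD.smooth_lee.toLinearMap S.reeb * hD.smooth_lee.toLinearMap S.reeb
    - algebraMap ℝ (SmoothFun (𝓡 (2 * n + 1)) M) ((2 * n - 1 : ℝ)⁻¹ * (2 * n * κ)), fun X ↦ ?_⟩
  refine (hnab.calculus S.metric_reeb_reeb).eq_of_forall fun Z ↦ ?_
  ext x
  obtain ⟨τ, hτ⟩ := exists_inner_nab_eq hS hnab hκ hκμ hD hθ hEW hU x
  have hξ : nab S.ξ x (S.ξ x) = 0 := congrArg (fun V : SmoothField _ M ↦ V x) hK.covDeriv_ξ
  have h1 := hτ (S.ξ x) (S.ξ x)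
  rw [hξ, map_zero, map_zero, S.η_ξ, S.g_ξ, S.g_ξ, S.η_ξ] at h1
  have hUZ : S.g.inner x (U x) (Z x) = θ x (Z x) :=
    congrArg (fun f : SmoothFun _ M ↦ f x) (hU Z)
  have hgs (v w : TangentSpace (𝓡 (2 * n + 1)) x) : S.g.inner x v w = S.g.inner x w v :=
    S.g.symm x v w
  refine (hτ (X x) (Z x)).trans ?_
  change _ = S.g.inner x (θ x (X x) • U x
    + (((2 * n - 1 : ℝ)⁻¹ * (2 * n * κ)) * S.g.inner x (X x) (S.ξ x)) • S.ξ x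
    + ((2 * n - 1 : ℝ)⁻¹ * μ) • S.φ x (nab S.ξ x (X x))
    + (S.g.inner x (nab U x (S.ξ x)) (S.ξ x) - θ x (S.ξ x) * θ x (S.ξ x)
      - (2 * n - 1 : ℝ)⁻¹ * (2 * n * κ)) • X x) (Z x)
  refine Eq.trans ?_ (hgs (Z x) _)
  simp only [map_add, map_smul, smul_eq_mul]
  rw [S.g_ξ, S.g_ξ, S.g_ξ, h1, hgs (Z x) (U x), hUZ, hgs (Z x) (X x)]
  ring

lemma horiz_reeb_eq_zero (hS : S.IsAlmostCosymplectic) (hnab : IsLeviCivita S.g nab)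
    (hκ : κ ≠ 0) (hκμ : S.IsKappaMu nab κ μ) (hW : AdmitsClosedEinsteinWeyl S.g)
    (X : SmoothField (𝓡 (2 * n + 1)) M) :
    (hnab.calculus S.metric_reeb_reeb).horiz S.reeb X = 0 := by
  -- For n = 0 tangent spaces are lines spanned by ξ. This case is separate because a = 2nκ/(2n-1)
  -- is then not invertible.
  rcases Nat.eq_zero_or_pos n with rfl | hn
  · rw [RiemannianCalculus.horiz_apply]
    ext x
    have hfin : Module.finrank ℝ (TangentSpace (𝓡 (2 * 0 + 1)) x) = 1 :=
      finrank_euclideanSpace_fin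
    have hξ : S.ξ x ≠ 0 := fun h ↦ by simpa [h] using S.η_ξ x
    obtain ⟨c, hc⟩ := (finrank_eq_one_iff_of_nonzero' (S.ξ x) hξ).1 hfin (X x)
    change X x - S.g.inner x (X x) (S.ξ x) • S.ξ x = 0
    rw [S.g_ξ, ← hc, map_smul, S.η_ξ, smul_eq_mul, mul_one, sub_self]
  have hK := isAlmostCosymplecticKappaMu hS hnab hκ hκμ
  obtain ⟨D, θ, hD, hθ, hEW⟩ := hW
  have hWeyl := hD.isClosedWeyl hθ hnab S.metric_reeb_reeb
  obtain ⟨U, hU⟩ := hWeyl.exists_dual S.metric_reeb_reeb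
  obtain ⟨σ, hσ⟩ := nab_dual_eq hS hnab hκ hκμ hD hθ hEW hU
  have hc : (2 * n - 1 : ℝ)⁻¹ ≠ 0 := by
    have : (1 : ℝ) ≤ n := by exact_mod_cast hn
    exact inv_ne_zero (by linarith)
  refine hK.horiz_eq_zero_of_nab_eq hU hWeyl.closed (fun _ ↦ Derivation.map_algebraMap _ _)
    (fun _ ↦ Derivation.map_algebraMap _ _) ((isUnit_iff_ne_zero.2 ?_).map (algebraMap ℝ _)) ?_ hσ X
  · have : (n : ℝ) ≠ 0 := by exact_mod_cast hn.ne'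
    positivity
  · rcases eq_or_ne μ 0 with rfl | hμ
    · right
      rw [mul_zero, map_zero]
      exact ⟨rfl, rfl⟩
    · exact Or.inl ((isUnit_iff_ne_zero.2 (mul_ne_zero hc hμ)).map (algebraMap ℝ _))

end AlmostContactMetricStructure

/-! ### Conclusion -/

/-- A Riemannian manifold of dimension at most one is flat. -/
lemma RiemannianCalculus.curv_eq_zero_of_horiz {C 𝔛 : Type*} [CommRing C] [Algebra ℝ C]
    [AddCommGroup 𝔛] [Module C 𝔛] (K : RiemannianCalculus C 𝔛) {ξ : 𝔛}
    (h : ∀ X, K.horiz ξ X = 0) (X Y Z : 𝔛) : K.curv X Y Z = 0 := by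
  have hX (X : 𝔛) : X = K.g X ξ • ξ := by rw [← sub_eq_zero, ← K.horiz_apply, h]
  have h0 : K.curv ξ ξ Z = 0 := by simp [curv]
  rw [hX X, curv_smul_left, curv_swap, hX Y, curv_smul_left, h0, smul_zero, neg_zero, smul_zero]

end

theorem theorem4p1 (n : ℕ) {M : Type*} [TopologicalSpace M] [T2Space M]
    [SecondCountableTopology M] [ChartedSpace (EuclideanSpace ℝ (Fin (2 * n + 1))) M]
    [IsManifold (𝓡 (2 * n + 1)) ∞ M]
    (S : AlmostContactMetricStructure n M) (hS : S.IsAlmostCosymplectic)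
    (nab : CovariantDerivative (𝓡 (2 * n + 1)) (EuclideanSpace ℝ (Fin (2 * n + 1)))
      (TangentSpace (𝓡 (2 * n + 1)) : M → Type _))
    (hnab : IsLeviCivita S.g nab)
    (κ μ : ℝ) (hκ : κ < 0) (hκμ : S.IsKappaMu nab κ μ)
    (hW : AdmitsClosedEinsteinWeyl S.g) :
    IsEinstein S.g nab ∨ S.IsCosymplectic := by
  -- All fields are multiples of ξ, so R = 0 by skew-symmetry and M is Ricci-flat.
  refine Or.inl ⟨0, fun x v w ↦ ?_⟩
  rw [zero_mul, ← map_zero (LinearMap.trace ℝ (TangentSpace (𝓡 (2 * n + 1)) x))]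
  refine hnab.ricci_eq_trace v w 0 fun X Y Z _ _ ↦ ?_
  exact congrArg (fun V : SmoothField _ M ↦ V x)
    ((hnab.calculus S.metric_reeb_reeb).curv_eq_zero_of_horiz
      (S.horiz_reeb_eq_zero hS hnab hκ.ne hκμ hW) X Y Z)
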